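/- Let $G$ be a compact connected Lie group and let $\rho: G\to SO(V)$ be an orthogonal representation on a finite-dimensional Euclidean vector space $V$. Suppose that $\rho$ is polar, i.e. there is a linear subspace $S\subseteq V$ that meets every $G$-orbit and meets the orbits orthogonally: $T_x(G.x)\perp S$ for every $x\in S$. Equip the orbit space $V/G$ with the metric $d$ for which $d(\bar p,\bar q)$ is the minimum of the lengths of all curves in $V$ that start on the orbit $\bar p$ and end on the orbit $\bar q$, and call a continuous curve in $V/G$ from $\bar p$ to $\bar q$ a minimal geodesic segment if its length (with respect to $d$) equals $d(\bar p,\bar q)$. Then any two points $\bar p,\bar q$ of $V/G$ are connected by a minimal geodesic segment, and this segment is unique up to reparametrization: there is a minimal geodesic segment $\gamma:[0,1]\to V/G$ from $\bar p$ to $\bar q$ such that every minimal geodesic segment $\delta:[0,1]\to V/G$ from $\bar p$ to $\bar q$ is of the form $\delta=\gamma\circ\varphi$ with $\varphi:[0,1]\to[0,1]$ continuous, nondecreasing, $\varphi(0)=0$ and $\varphi(1)=1$. -/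

import Mathlib

open Set
open scoped ENNReal Manifold ContDiff

noncomputable section

/-- The length of a continuous curve in a (pseudo-)metric space: the supremum, over all partitions
of the parameter interval, of the sums of the distances of consecutive points. -/
def curveLength {X : Type*} [PseudoEMetricSpace X] {p q : X} (γ : Path p q) : ℝ≥0∞ :=
  eVariationOn (γ : unitInterval → X) univ

/-- A minimal geodesic segment: a curve whose length is the distance of its end points. -/
def IsMinimalGeodesicSegment {X : Type*} [PseudoEMetricSpace X] {p q : X} (γ : Path p q) : Prop :=
  curveLength γ = edist p q

/-- `δ` is obtained from `γ` by a continuous monotone change of parameter fixing the end points. -/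
def IsReparametrizationOf {X : Type*} [TopologicalSpace X] {p q : X} (δ γ : Path p q) : Prop :=
  ∃ (φ : unitInterval → unitInterval) (hφ : Continuous φ) (h0 : φ 0 = 0) (h1 : φ 1 = 1),
    Monotone φ ∧ δ = γ.reparam φ hφ h0 h1

/-- An orthogonal representation of a topological group `G` on a Euclidean space `V`: a continuous
homomorphism from `G` to the group of linear isometries of `V`. (For a Lie group such a
homomorphism is smooth, and for connected `G` it takes values in the special orthogonal group.) -/
structure OrthogonalRepresentation (G V : Type*) [Group G] [TopologicalSpace G]
    [NormedAddCommGroup V] [InnerProductSpace ℝ V] where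
  toHom : G →* (V ≃ₗᵢ[ℝ] V)
  continuous_apply : ∀ v : V, Continuous fun g : G => toHom g v

namespace OrthogonalRepresentation

variable {G V : Type*} [Group G] [TopologicalSpace G]
  [NormedAddCommGroup V] [InnerProductSpace ℝ V] (ρ : OrthogonalRepresentation G V)

/-- The orbit `G.x`. -/
def orbit (x : V) : Set V := range fun g : G => ρ.toHom g x

/-- The tangent vectors at `x` of a subset `N` of `V` (an orbit of a compact Lie group, which is a
submanifold): the velocities at `x` of the smooth curves that lie in `N`. -/
def _root_.tangentVectors (N : Set V) (x : V) : Set V :=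
  {v | ∃ c : ℝ → V, ContDiff ℝ ∞ c ∧ (∀ t, c t ∈ N) ∧ c 0 = x ∧ deriv c 0 = v}

/-- A linear section: a vector subspace that meets every orbit, and meets it orthogonally at each
point of intersection. -/
def IsSection (S : Submodule ℝ V) : Prop :=
  (∀ x : V, (ρ.orbit x ∩ S).Nonempty) ∧
    ∀ x ∈ S, ∀ v ∈ tangentVectors (ρ.orbit x) x, ∀ w ∈ S, inner ℝ v w = 0

/-- A polar representation is one that admits a linear section. -/
def IsPolar : Prop := ∃ S : Submodule ℝ V, ρ.IsSection S

/-- Two vectors are equivalent when they lie in the same orbit. -/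
def orbitSetoid : Setoid V where
  r x y := ∃ g : G, ρ.toHom g x = y
  iseqv :=
    { refl := fun x => ⟨1, by simp⟩
      symm := by
        rintro x y ⟨g, rfl⟩
        refine ⟨g⁻¹, ?_⟩
        rw [← Function.comp_apply (f := ρ.toHom g⁻¹), ← LinearIsometryEquiv.coe_mul, ← map_mul]
        simp
      trans := by
        rintro x y z ⟨g, rfl⟩ ⟨h, rfl⟩
        exact ⟨h * g, by simp⟩ }

/-- The orbit space `V/G`. -/
def OrbitSpace : Type _ := Quotient ρ.orbitSetoid

/-- The projection `V → V/G`. -/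
def proj (x : V) : ρ.OrbitSpace := Quotient.mk ρ.orbitSetoid x

theorem proj_surjective : Function.Surjective ρ.proj := Quotient.mk_surjective

theorem proj_eq_iff {x y : V} : ρ.proj x = ρ.proj y ↔ ∃ g : G, ρ.toHom g x = y :=
  Quotient.eq (r := ρ.orbitSetoid)

/-- The distance of two orbits: the infimum of the lengths of all curves in `V` that start on the
first orbit and end on the second one. -/
instance : EDist ρ.OrbitSpace where
  edist p q := ⨅ (x : V) (_ : ρ.proj x = p) (y : V) (_ : ρ.proj y = q) (γ : Path x y),
    curveLength γ

theorem edist_def (p q : ρ.OrbitSpace) : edist p q =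
    ⨅ (x : V) (_ : ρ.proj x = p) (y : V) (_ : ρ.proj y = q) (γ : Path x y), curveLength γ := rfl

theorem _root_.edist_le_curveLength {X : Type*} [PseudoEMetricSpace X] {p q : X} (γ : Path p q) :
    edist p q ≤ curveLength γ := by
  have h := eVariationOn.edist_le (γ : unitInterval → X) (mem_univ 0) (mem_univ 1)
  simpa [curveLength] using h

theorem _root_.exists_curveLength_eq (x y : V) : ∃ γ : Path x y, curveLength γ = edist x y := by
  let γ : Path x y :=
    { toFun := fun t => AffineMap.lineMap x y (t : ℝ)
      continuous_toFun := by
        simp only [AffineMap.lineMap_apply_module]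
        fun_prop
      source' := by simp
      target' := by simp }
  refine ⟨γ, le_antisymm ?_ (edist_le_curveLength γ)⟩
  have hlip : LipschitzWith (nndist x y) fun t : ℝ => (AffineMap.lineMap x y t : V) :=
    lipschitzWith_lineMap x y
  have hmono : MonotoneOn (fun t : unitInterval => (t : ℝ)) univ := fun a _ b _ h => h
  have h1 := (hlip.lipschitzOnWith (s := univ)).comp_eVariationOn_le
    (mapsTo_univ (fun t : unitInterval => (t : ℝ)) univ)
  have h2 : eVariationOn (fun t : unitInterval => (t : ℝ)) univ ≤ 1 := by
    have h3 := hmono.eVariationOn_eq (mem_univ (0 : unitInterval)) (mem_univ (1 : unitInterval))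
    have h4 : (univ : Set unitInterval) ∩ Icc 0 1 = univ := by
      ext t; simpa using unitInterval.le_one' (t := t)
    rw [h4] at h3
    simp [h3]
  calc curveLength γ ≤ (nndist x y : ℝ≥0∞) *
        eVariationOn (fun t : unitInterval => (t : ℝ)) univ := h1
    _ ≤ (nndist x y : ℝ≥0∞) * 1 := by gcongr
    _ = edist x y := by rw [mul_one, edist_nndist]

theorem edist_proj (x y : V) : edist (ρ.proj x) (ρ.proj y) = ⨅ g : G, edist x (ρ.toHom g y) := by
  apply le_antisymm
  · refine le_iInf fun g => ?_
    obtain ⟨γ, hγ⟩ := exists_curveLength_eq x (ρ.toHom g y)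
    rw [← hγ, edist_def]
    exact iInf_le_of_le x (iInf_le_of_le rfl (iInf_le_of_le (ρ.toHom g y)
      (iInf_le_of_le ((ρ.proj_eq_iff.2 ⟨g, rfl⟩).symm) (iInf_le _ γ))))
  · rw [edist_def]
    refine le_iInf fun x' => le_iInf fun hx => le_iInf fun y' => le_iInf fun hy => le_iInf fun γ => ?_
    obtain ⟨a, rfl⟩ := ρ.proj_eq_iff.1 hx
    obtain ⟨b, hb⟩ := ρ.proj_eq_iff.1 hy.symm
    refine le_trans (iInf_le _ (a * b)) (le_trans (le_of_eq ?_) (edist_le_curveLength γ))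
    rw [map_mul, LinearIsometryEquiv.coe_mul, Function.comp_apply,
      LinearIsometryEquiv.edist_map, hb]

theorem edist_proj_le (x y : V) : edist (ρ.proj x) (ρ.proj y) ≤ edist x y := by
  rw [edist_proj]
  exact iInf_le_of_le 1 (by simp)

/-- The orbit space as a pseudo-metric space. -/
instance : PseudoEMetricSpace ρ.OrbitSpace where
  edist_self p := by
    obtain ⟨x, rfl⟩ := ρ.proj_surjective p
    exact le_antisymm ((ρ.edist_proj_le x x).trans (by simp)) bot_le
  edist_comm p q := by
    obtain ⟨x, rfl⟩ := ρ.proj_surjective p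
    obtain ⟨y, rfl⟩ := ρ.proj_surjective q
    have key : ∀ a b : V, edist (ρ.proj a) (ρ.proj b) ≤ edist (ρ.proj b) (ρ.proj a) := by
      intro a b
      rw [ρ.edist_proj b a]
      refine le_iInf fun g => ?_
      rw [edist_comm, (ρ.proj_eq_iff (x := a)).2 ⟨g, rfl⟩]
      exact ρ.edist_proj_le _ _
    exact le_antisymm (key x y) (key y x)
  edist_triangle p q r := by
    obtain ⟨x, rfl⟩ := ρ.proj_surjective p
    obtain ⟨y, rfl⟩ := ρ.proj_surjective q
    obtain ⟨z, rfl⟩ := ρ.proj_surjective r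
    rw [ρ.edist_proj x y, ρ.edist_proj y z]
    refine ENNReal.le_iInf_add_iInf fun g h => ?_
    calc edist (ρ.proj x) (ρ.proj z)
        = edist (ρ.proj x) (ρ.proj (ρ.toHom (g * h) z)) := by
          rw [← (ρ.proj_eq_iff (x := z)).2 ⟨g * h, rfl⟩]
      _ ≤ edist x (ρ.toHom (g * h) z) := ρ.edist_proj_le _ _
      _ ≤ edist x (ρ.toHom g y) + edist (ρ.toHom g y) (ρ.toHom (g * h) z) :=
          edist_triangle _ _ _
      _ = edist x (ρ.toHom g y) + edist y (ρ.toHom h z) := by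
          rw [map_mul, LinearIsometryEquiv.coe_mul, Function.comp_apply,
            LinearIsometryEquiv.edist_map]

theorem edist_orbitSpace_ne_top (p q : ρ.OrbitSpace) : edist p q ≠ ⊤ := by
  obtain ⟨x, rfl⟩ := ρ.proj_surjective p
  obtain ⟨y, rfl⟩ := ρ.proj_surjective q
  exact ne_top_of_le_ne_top (edist_ne_top x y) (ρ.edist_proj_le x y)

/-- For a compact group the orbit space is a metric space. -/
instance [CompactSpace G] : EMetricSpace ρ.OrbitSpace where
  eq_of_edist_eq_zero := by
    intro p q h
    obtain ⟨x, rfl⟩ := ρ.proj_surjective p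
    obtain ⟨y, rfl⟩ := ρ.proj_surjective q
    have hc : Continuous fun g : G => edist x (ρ.toHom g y) :=
      continuous_const.edist (ρ.continuous_apply y)
    obtain ⟨g, -, hg⟩ := isCompact_univ.exists_isMinOn ⟨(1 : G), mem_univ _⟩ hc.continuousOn
    have h0 : edist x (ρ.toHom g y) = 0 := by
      refine le_antisymm ?_ zero_le
      rw [← h, edist_proj]
      exact le_iInf fun k => hg (mem_univ k)
    exact (ρ.proj_eq_iff.2 ⟨g, (edist_eq_zero.1 h0).symm⟩).symm

/-- For a compact group the orbit space is a metric space. -/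
instance [CompactSpace G] : MetricSpace ρ.OrbitSpace :=
  EMetricSpace.toMetricSpace ρ.edist_orbitSpace_ne_top

end OrthogonalRepresentation

end

/-! Replace `G` by its image `K`, a compact connected group of orthogonal operators. It suffices to
find a convex subset of `V` that the projection maps isometrically onto `V/G`, because in a convex
set the straight segment is the only shortest curve up to parametrization
(`exists_unique_minimalGeodesicSegment`). Such a set is a Weyl chamber.

A dimension count (`exists_tang_orthogonal_le`) yields a point `y` of the section whose normal space
lies in the section, so that this normal space `K.nu ⊤ y` is itself orthogonal to the orbits. The
chamber consists of those `s` in it with `⟪X s, X y⟫ ≥ 0` for all `X` in the Lie algebra. The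
conditions are linear in `s`, so the chamber is a closed convex cone. They are also the second order
conditions for `s` to maximize `⟪·, y⟫` on its orbit, so every orbit meets the chamber
(`exists_apply_mem_chamber`).

The core is `chamberIsFundamental`: an orbit meets the chamber only once. The proof is by induction
on the dimension of the invariant subspace `U`. Fixed vectors of the section split off. If there are
none, the slice representations at nonzero points `p` of the section live in smaller spaces; they
are polar with the same section (`slice`, `nu_stab0`), and near a chamber point `p` the chamber
agrees with that of the slice (`eventually_mem_chamber`). Over a compact set avoiding the origin,
the pairs `(b, k)` with `k⁻¹ b` in the chamber, modulo the identity component of the isotropy group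
of `b` and the pointwise stabilizer of the section, therefore form a covering space
(`isCoveringMap`). If `v` and `w v` both lie in the chamber, lift the cone over the orbit of `v`
from a chamber point: at its end over `w` the lift is at once the class of `(w v, 1)` and that of
`(w v, w)`, which forces `w v = v` (`apply_eq_of_cone`). The cone can be made to avoid the origin
once the section has dimension at least two, because an orbit meets the section in a finite set; in
dimension at most one the chamber is a ray or a point and norms decide.

For the isometry, a chamber point `x` must maximize `⟪·, z⟫` on its orbit for each chamber point `z`
(`inner_apply_le`). If `z` is regular, a maximizer satisfies the chamber conditions relative to `z`;
comparing two symmetric operators turns them into those relative to `y`, and uniqueness identifies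
the maximizer with `x`. General `z` follow by a limit. -/

section Polar

open Filter Topology NormedSpace

set_option linter.unusedSectionVars false

/-! ### The exponential map near the identity. -/

section ExpReal

variable {A : Type*} [NormedRing A] [NormedAlgebra ℝ A] [CompleteSpace A]

theorem exp_add_of_commute_real {x y : A} (h : Commute x y) : exp (x + y) = exp x * exp y := by
  let : NormedAlgebra ℚ A := NormedAlgebra.restrictScalars ℚ ℝ A
  exact exp_add_of_commute h

theorem exp_nsmul_real (n : ℕ) (x : A) : exp (n • x) = exp x ^ n := by
  let : NormedAlgebra ℚ A := NormedAlgebra.restrictScalars ℚ ℝ A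
  exact exp_nsmul n x

theorem exp_continuous_real : Continuous (exp : A → A) := by
  let : NormedAlgebra ℚ A := NormedAlgebra.restrictScalars ℚ ℝ A
  exact exp_continuous

theorem exp_mul_exp_neg (x : A) : exp x * exp (-x) = 1 := by
  rw [← exp_add_of_commute_real (Commute.neg_right rfl), add_neg_cancel, exp_zero]

theorem exp_neg_mul_exp (x : A) : exp (-x) * exp x = 1 := by
  simpa using exp_mul_exp_neg (-x)

theorem exp_conj_of_mul_eq_one {a b : A} (hab : a * b = 1) (hba : b * a = 1) (x : A) :
    exp (a * x * b) = a * exp x * b := by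
  let : NormedAlgebra ℚ A := NormedAlgebra.restrictScalars ℚ ℝ A
  exact exp_units_conj ⟨a, b, hab, hba⟩ x

theorem hasStrictFDerivAt_exp_zero_id :
    HasStrictFDerivAt (exp : A → A) (ContinuousLinearMap.id ℝ A) 0 :=
  hasStrictFDerivAt_exp_zero (𝕂 := ℝ)

/-- Near the identity the exponential has a right inverse that is differentiable at `1`. -/
theorem exists_local_log : ∃ log : A → A, log 1 = 0 ∧
    HasFDerivAt log (ContinuousLinearMap.id ℝ A) 1 ∧ ∀ᶠ u in 𝓝 (1 : A), exp (log u) = u := by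
  have h : HasStrictFDerivAt (exp : A → A) ((ContinuousLinearEquiv.refl ℝ A : A ≃L[ℝ] A) : A →L[ℝ] A)
      0 := hasStrictFDerivAt_exp_zero_id
  refine ⟨h.localInverse, ?_, ?_, ?_⟩
  · have := h.localInverse_apply_image
    rwa [exp_zero] at this
  · have := h.to_localInverse.hasFDerivAt
    rw [exp_zero] at this
    exact this
  · have := h.eventually_right_inverse
    rwa [exp_zero] at this

/-- If three subspaces span a finite-dimensional algebra, the elements near `1` are products of
exponentials of small elements of these subspaces. -/
theorem eventually_exists_exp_mul_exp_mul_exp [FiniteDimensional ℝ A] {m l n : Submodule ℝ A}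
    (h : m ⊔ l ⊔ n = ⊤) {N : Set A} (hN : N ∈ 𝓝 (0 : A)) :
    ∀ᶠ g in 𝓝 (1 : A), ∃ Z ∈ m, Z ∈ N ∧ ∃ Y ∈ l, Y ∈ N ∧ ∃ W ∈ n, W ∈ N ∧
      g = exp Z * exp Y * exp W := by
  let p1 : m × l × n →L[ℝ] A := m.subtypeL ∘L .fst ℝ _ _
  let p2 : m × l × n →L[ℝ] A := l.subtypeL ∘L .fst ℝ _ _ ∘L .snd ℝ _ _
  let p3 : m × l × n →L[ℝ] A := n.subtypeL ∘L .snd ℝ _ _ ∘L .snd ℝ _ _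
  let Φ : m × l × n → A := fun x => exp (p1 x) * exp (p2 x) * exp (p3 x)
  have e : ∀ p : m × l × n →L[ℝ] A,
      HasStrictFDerivAt (fun x => exp (p x)) p 0 := fun p => by
    have h : HasStrictFDerivAt (exp : A → A) (ContinuousLinearMap.id ℝ _) (p 0) := by
      rw [map_zero]; exact hasStrictFDerivAt_exp_zero_id
    exact h.comp (0 : m × l × n) p.hasStrictFDerivAt
  -- The derivative at `0` is `(Z, Y, W) ↦ Z + Y + W`, which is onto; hence `Φ` maps neighbourhoods
  -- of `0` to neighbourhoods of `1`.
  have hΦ : HasStrictFDerivAt Φ (p1 + p2 + p3) 0 := by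
    have h12 := (e p1).fun_mul' (e p2)
    have := h12.fun_mul' (e p3)
    refine this.congr_fderiv ?_
    ext x
    all_goals simp [p1, p2, p3]
  have hsurj : (p1 + p2 + p3 : m × l × n →L[ℝ] A).range = ⊤ := by
    rw [LinearMap.range_eq_top]
    intro X
    have : X ∈ m ⊔ l ⊔ n := by rw [h]; trivial
    obtain ⟨T, hT, W, hW, rfl⟩ := Submodule.mem_sup.1 this
    obtain ⟨Z, hZ, Y, hY, rfl⟩ := Submodule.mem_sup.1 hT
    exact ⟨(⟨Z, hZ⟩, ⟨Y, hY⟩, ⟨W, hW⟩), rfl⟩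
  have := FiniteDimensional.complete ℝ (m × l × n)
  have hmap := hΦ.map_nhds_eq_of_surj hsurj
  have hΦ0 : Φ 0 = 1 := by simp [Φ]
  rw [hΦ0] at hmap
  have hp : ∀ p : m × l × n →L[ℝ] A, ∀ᶠ x in 𝓝 (0 : m × l × n), p x ∈ N := fun p =>
    p.continuous.continuousAt (by rw [map_zero]; exact hN)
  rw [← hmap, eventually_map]
  filter_upwards [hp p1, hp p2, hp p3] with x h1 h2 h3
  exact ⟨p1 x, x.1.2, h1, p2 x, x.2.1.2, h2, p3 x, x.2.2.2, h3, rfl⟩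

end ExpReal

/-! ### Compact orthogonal groups and their Lie algebras. -/

variable {V : Type*} [NormedAddCommGroup V] [InnerProductSpace ℝ V] [FiniteDimensional ℝ V]
  [CompleteSpace V]

variable (V) in
/-- A compact group of orthogonal transformations of a Euclidean space, as a set of operators. -/
structure OrthGroup where
  carrier : Set (V →L[ℝ] V)
  one_mem' : 1 ∈ carrier
  mul_mem' : ∀ {a b}, a ∈ carrier → b ∈ carrier → a * b ∈ carrier
  star_mem' : ∀ {a}, a ∈ carrier → star a ∈ carrier
  star_mul' : ∀ {a}, a ∈ carrier → star a * a = 1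
  isCompact' : IsCompact carrier

namespace OrthGroup

instance : SetLike (OrthGroup V) (V →L[ℝ] V) where
  coe := carrier
  coe_injective K H h := by cases K; cases H; congr

variable {K H : OrthGroup V} {a b : V →L[ℝ] V}

theorem one_mem : (1 : V →L[ℝ] V) ∈ K := K.one_mem'
theorem mul_mem (ha : a ∈ K) (hb : b ∈ K) : a * b ∈ K := K.mul_mem' ha hb
theorem star_mem (ha : a ∈ K) : star a ∈ K := K.star_mem' ha
theorem star_mul (ha : a ∈ K) : star a * a = 1 := K.star_mul' ha
theorem mul_star (ha : a ∈ K) : a * star a = 1 := by simpa using K.star_mul (K.star_mem ha)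
theorem isCompact : IsCompact (K : Set (V →L[ℝ] V)) := K.isCompact'
theorem isClosed : IsClosed (K : Set (V →L[ℝ] V)) := K.isCompact.isClosed

theorem pow_mem (ha : a ∈ K) (n : ℕ) : a ^ n ∈ K := by
  induction n with
  | zero => simpa using K.one_mem
  | succ n ih => rw [pow_succ]; exact K.mul_mem ih ha

theorem star_apply_apply (ha : a ∈ K) (v : V) : star a (a v) = v := by
  rw [← mul_apply_eq_comp, K.star_mul ha, one_apply_eq_self]

theorem apply_star_apply (ha : a ∈ K) (v : V) : a (star a v) = v := by
  rw [← mul_apply_eq_comp, K.mul_star ha, one_apply_eq_self]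

theorem inner_star_apply (a : V →L[ℝ] V) (v w : V) : inner ℝ (star a v) w = inner ℝ v (a w) := by
  rw [ContinuousLinearMap.star_eq_adjoint, ContinuousLinearMap.adjoint_inner_left]

theorem inner_apply_apply (ha : a ∈ K) (v w : V) : inner ℝ (a v) (a w) = inner ℝ v w := by
  rw [← inner_star_apply, star_apply_apply ha]

theorem norm_apply (ha : a ∈ K) (v : V) : ‖a v‖ = ‖v‖ := by
  rw [@norm_eq_sqrt_real_inner V, inner_apply_apply ha, ← norm_eq_sqrt_real_inner]

theorem star_eq_of_apply_eq (ha : a ∈ K) {v w : V} (h : a v = w) : star a w = v := by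
  rw [← h, star_apply_apply ha]

theorem star_exp_of_mem {X : V →L[ℝ] V} (h : exp X ∈ K) : star (exp X) = exp (-X) := by
  calc star (exp X) = star (exp X) * (exp X * exp (-X)) := by rw [exp_mul_exp_neg, mul_one]
    _ = exp (-X) := by rw [← mul_assoc, K.star_mul h, one_mul]

theorem exp_neg_mem {X : V →L[ℝ] V} (h : exp X ∈ K) : exp (-X) ∈ K := by
  rw [← star_exp_of_mem h]; exact K.star_mem h

/-- A limit of rescaled logarithms of group elements generates a one-parameter subgroup. -/
theorem exp_smul_mem_of_tendsto {ι : Type*} {l : Filter ι} [l.NeBot] {Y : ι → V →L[ℝ] V}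
    {r : ι → ℝ} {X : V →L[ℝ] V} (hr : Tendsto r l atTop) (hY : ∀ᶠ i in l, exp (Y i) ∈ K)
    (h : Tendsto (fun i => r i • Y i) l (𝓝 X)) (t : ℝ) : exp (t • X) ∈ K := by
  have key : ∀ t : ℝ, 0 ≤ t → exp (t • X) ∈ K := by
    intro t ht
    -- Rounding `t * r i` down to an integer makes the exponential a power of `exp (Y i)`, hence an
    -- element of `K`, without changing the limit.
    have h1 : Tendsto (fun i => (⌊t * r i⌋₊ / r i : ℝ) • (r i • Y i)) l (𝓝 (t • X)) :=
      ((tendsto_nat_floor_mul_div_atTop ht).comp hr).smul h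
    have h2 := (exp_continuous_real.tendsto _).comp h1
    refine K.isClosed.mem_of_tendsto h2 ?_
    filter_upwards [hY, hr.eventually_gt_atTop 0] with i hi hri
    have : (⌊t * r i⌋₊ / r i : ℝ) • (r i • Y i) = ⌊t * r i⌋₊ • Y i := by
      rw [smul_smul, div_mul_cancel₀ _ hri.ne', Nat.cast_smul_eq_nsmul]
    simp only [Function.comp_apply, this, exp_nsmul_real]
    exact K.pow_mem hi _
  rcases le_total 0 t with ht | ht
  · exact key t ht
  · have := K.exp_neg_mem (key (-t) (by linarith))
    simpa using this

/-- The Lie algebra of a compact group of orthogonal transformations. -/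
def lie (K : OrthGroup V) : Submodule ℝ (V →L[ℝ] V) where
  carrier := {X | ∀ t : ℝ, exp (t • X) ∈ K}
  zero_mem' t := by simpa using K.one_mem
  smul_mem' c X hX t := by rw [smul_smul]; exact hX _
  add_mem' := by
    intro X Z hX hZ
    obtain ⟨log, log1, hlog, hexp⟩ := exists_local_log (A := V →L[ℝ] V)
    have hd : HasDerivAt (fun t : ℝ => exp (t • X) * exp (t • Z)) (X + Z) 0 := by
      have := (hasDerivAt_exp_smul_const (𝕂 := ℝ) X 0).fun_mul
        (hasDerivAt_exp_smul_const (𝕂 := ℝ) Z 0)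
      refine this.congr_deriv ?_
      simp
    have hd0 : (fun t : ℝ => exp (t • X) * exp (t • Z)) 0 = 1 := by simp
    -- The curve `t⁻¹ • log (exp (t • X) * exp (t • Z))` tends to `X + Z` as `t` decreases to `0`,
    -- so the criterion on rescaled logarithms applies.
    have hlog' : HasFDerivAt log (ContinuousLinearMap.id ℝ _)
      ((fun t : ℝ => exp (t • X) * exp (t • Z)) 0) := by rw [hd0]; exact hlog
    have hc : HasDerivAt (fun t : ℝ => log (exp (t • X) * exp (t • Z))) (X + Z) 0 :=
      hlog'.comp_hasDerivAt (f := fun t : ℝ => exp (t • X) * exp (t • Z)) (0 : ℝ) hd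
    have hc' := hc.tendsto_slope_zero_right
    simp only [zero_add, zero_smul, exp_zero, mul_one, log1, sub_zero] at hc'
    refine exp_smul_mem_of_tendsto tendsto_inv_nhdsGT_zero ?_ hc'
    have h1 : Tendsto (fun t : ℝ => exp (t • X) * exp (t • Z)) (𝓝[>] 0) (𝓝 1) := by
      have := hd.continuousAt.tendsto
      simp only [zero_smul, exp_zero, mul_one] at this
      exact this.mono_left nhdsWithin_le_nhds
    filter_upwards [h1.eventually hexp] with t ht
    rw [ht]
    exact K.mul_mem (hX t) (hZ t)

theorem mem_lie {X : V →L[ℝ] V} : X ∈ K.lie ↔ ∀ t : ℝ, exp (t • X) ∈ K := Iff.rfl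

theorem exp_mem {X : V →L[ℝ] V} (hX : X ∈ K.lie) : exp X ∈ K := by simpa using hX 1

theorem lie_mono (h : (H : Set (V →L[ℝ] V)) ⊆ K) : H.lie ≤ K.lie := fun _ hX t => h (hX t)

theorem isClosed_lie : IsClosed (K.lie : Set (V →L[ℝ] V)) := Submodule.closed_of_finiteDimensional _

theorem conj_mem_lie {X : V →L[ℝ] V} (ha : a ∈ K) (hX : X ∈ K.lie) : a * X * star a ∈ K.lie := by
  intro t
  have : t • (a * X * star a) = a * (t • X) * star a := by simp
  rw [this, exp_conj_of_mul_eq_one (K.mul_star ha) (K.star_mul ha)]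
  exact K.mul_mem (K.mul_mem ha (hX t)) (K.star_mem ha)

theorem hasDerivAt_exp_smul_zero (X : V →L[ℝ] V) :
    HasDerivAt (fun t : ℝ => exp (t • X)) X 0 := by
  simpa using hasDerivAt_exp_smul_const (𝕂 := ℝ) X 0

theorem hasDerivAt_exp_smul_apply (X : V →L[ℝ] V) (v : V) :
    HasDerivAt (fun t : ℝ => exp (t • X) v) (X v) 0 :=
  by
  have := ((ContinuousLinearMap.apply ℝ V v).hasFDerivAt).comp_hasDerivAt (0 : ℝ)
    (hasDerivAt_exp_smul_zero X)
  exact this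

theorem mem_of_hasDerivAt {E : Type*} [NormedAddCommGroup E] [NormedSpace ℝ E]
    {S : Submodule ℝ E} (hS : IsClosed (S : Set E)) {f : ℝ → E} {f' : E} (hf : HasDerivAt f f' 0)
    (h : ∀ t, f t ∈ S) : f' ∈ S := by
  refine hS.mem_of_tendsto hf.tendsto_slope_zero_right (Eventually.of_forall fun t => ?_)
  exact S.smul_mem _ (S.sub_mem (h _) (h _))

/-- The bracket is the velocity at `0` of the conjugates of `Z` by `exp (t • X)`, a curve in the Lie
algebra, which is closed. -/
theorem bracket_mem_lie {X Z : V →L[ℝ] V} (hX : X ∈ K.lie) (hZ : Z ∈ K.lie) :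
    X * Z - Z * X ∈ K.lie := by
  have hd : HasDerivAt (fun t : ℝ => exp (t • X) * Z * exp (t • (-X))) (X * Z - Z * X) 0 := by
    have := ((hasDerivAt_exp_smul_zero X).mul_const Z).fun_mul (hasDerivAt_exp_smul_zero (-X))
    refine this.congr_deriv ?_
    simp [sub_eq_add_neg]
  refine mem_of_hasDerivAt isClosed_lie hd fun t => ?_
  rw [smul_neg, ← star_exp_of_mem (hX t)]
  exact conj_mem_lie (hX t) hZ

theorem inner_lie {X : V →L[ℝ] V} (hX : X ∈ K.lie) (v w : V) :
    inner ℝ (X v) w = - inner ℝ v (X w) := by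
  have h1 : HasDerivAt (fun t : ℝ => inner ℝ (exp (t • X) v) (exp (t • X) w))
      (inner ℝ v (X w) + inner ℝ (X v) w) 0 := by
    have := (hasDerivAt_exp_smul_apply X v).inner ℝ (hasDerivAt_exp_smul_apply X w)
    simpa using this
  have h2 : (fun t : ℝ => inner ℝ (exp (t • X) v) (exp (t • X) w)) = fun _ => inner ℝ v w := by
    ext t; exact inner_apply_apply (hX t) v w
  rw [h2] at h1
  have := h1.unique (hasDerivAt_const _ _)
  linarith

/-- Small elements of a complement of the Lie algebra do not exponentiate into the group. -/
theorem eventually_eq_zero_of_exp_mem {n : Submodule ℝ (V →L[ℝ] V)} (hn : n ⊓ K.lie = ⊥) :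
    ∀ᶠ W in 𝓝 (0 : V →L[ℝ] V), W ∈ n → exp W ∈ K → W = 0 := by
  by_contra hcon
  have hfr : ∃ᶠ W in 𝓝 (0 : V →L[ℝ] V), W ∈ n ∧ exp W ∈ K ∧ W ≠ 0 := by
    rw [Filter.not_eventually] at hcon
    exact hcon.mono fun W hW => by tauto
  have hne : (𝓝 (0 : V →L[ℝ] V) ⊓ 𝓟 {W | W ∈ n ∧ exp W ∈ K ∧ W ≠ 0}).NeBot :=
    frequently_mem_iff_neBot.1 hfr
  -- Along an ultrafilter of counterexamples tending to `0`, the directions `‖W‖⁻¹ • W` converge on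
  -- the compact unit sphere. The limit is a unit vector in both `n` and the Lie algebra.
  let l : Ultrafilter (V →L[ℝ] V) := Ultrafilter.of (𝓝 (0 : V →L[ℝ] V) ⊓ 𝓟 {W | W ∈ n ∧ exp W ∈ K ∧ W ≠ 0})
  have hl : (l : Filter (V →L[ℝ] V)) ≤ 𝓝 0 ⊓ 𝓟 {W | W ∈ n ∧ exp W ∈ K ∧ W ≠ 0} := Ultrafilter.of_le _
  have hl0 : Tendsto id (l : Filter (V →L[ℝ] V)) (𝓝 0) := hl.trans inf_le_left
  have hlW : ∀ᶠ W in (l : Filter (V →L[ℝ] V)), W ∈ n ∧ exp W ∈ K ∧ W ≠ 0 := by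
    have : (l : Filter (V →L[ℝ] V)) ≤ 𝓟 {W | W ∈ n ∧ exp W ∈ K ∧ W ≠ 0} := hl.trans inf_le_right
    exact this (mem_principal_self _)
  have : ProperSpace (V →L[ℝ] V) := FiniteDimensional.proper ℝ _
  have hcomp : IsCompact (Metric.sphere (0 : V →L[ℝ] V) 1) := isCompact_sphere _ _
  obtain ⟨X, hX1, hX⟩ := hcomp.ultrafilter_le_nhds (l.map fun W => ‖W‖⁻¹ • W) (by
    rw [le_principal_iff]
    change ∀ᶠ W in (l : Filter (V →L[ℝ] V)), ‖W‖⁻¹ • W ∈ Metric.sphere (0 : V →L[ℝ] V) 1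
    filter_upwards [hlW] with W hW
    have : ‖W‖ ≠ 0 := norm_ne_zero_iff.2 hW.2.2
    simp [norm_smul, this])
  have hX' : Tendsto (fun W : V →L[ℝ] V => ‖W‖⁻¹ • W) l (𝓝 X) := hX
  have hr : Tendsto (fun W : V →L[ℝ] V => ‖W‖⁻¹) (l : Filter (V →L[ℝ] V)) atTop := by
    refine tendsto_inv_nhdsGT_zero.comp (tendsto_nhdsWithin_iff.2 ⟨?_, ?_⟩)
    · simpa using hl0.norm
    · filter_upwards [hlW] with W hW
      simpa using hW.2.2
  have hXlie : X ∈ K.lie := fun t =>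
    exp_smul_mem_of_tendsto hr (hlW.mono fun W hW => hW.2.1) hX' t
  have hXn : X ∈ n := (Submodule.closed_of_finiteDimensional n).mem_of_tendsto hX'
    (hlW.mono fun W hW => n.smul_mem _ hW.1)
  have : X ∈ n ⊓ K.lie := ⟨hXn, hXlie⟩
  rw [hn, Submodule.mem_bot] at this
  simp [this] at hX1

/-- Group elements near the identity are products of exponentials from two subspaces that span
the Lie algebra. -/
theorem eventually_exists_exp_mul_exp {l m : Submodule ℝ (V →L[ℝ] V)} (hlm : l ⊔ m = K.lie)
    {N : Set (V →L[ℝ] V)} (hN : N ∈ 𝓝 (0 : V →L[ℝ] V)) :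
    ∀ᶠ g in 𝓝 (1 : V →L[ℝ] V), g ∈ K →
      ∃ Z ∈ m, Z ∈ N ∧ ∃ Y ∈ l, Y ∈ N ∧ g = exp Z * exp Y := by
  obtain ⟨n, hn⟩ := Submodule.exists_isCompl K.lie
  have hn0 := eventually_eq_zero_of_exp_mem (K := K) (n := n) (by rw [inf_comm]; exact hn.inf_eq_bot)
  have htop : m ⊔ l ⊔ n = ⊤ := by rw [sup_comm m l, hlm, hn.sup_eq_top]
  filter_upwards [eventually_exists_exp_mul_exp_mul_exp htop (inter_mem hN hn0)] with g hg hgK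
  obtain ⟨Z, hZm, hZN, Y, hYl, hYN, W, hWn, hWN, rfl⟩ := hg
  have hm : m ≤ K.lie := hlm ▸ le_sup_right
  have hl : l ≤ K.lie := hlm ▸ le_sup_left
  have hZ : exp Z ∈ K := exp_mem (hm hZm)
  have hY : exp Y ∈ K := exp_mem (hl hYl)
  -- Since `g`, `exp Z` and `exp Y` are in `K`, so is `exp W`; being small and transversal to the
  -- Lie algebra, `W` vanishes.
  have hW : exp W = star (exp Z * exp Y) * (exp Z * exp Y * exp W) := by
    rw [← mul_assoc, K.star_mul (K.mul_mem hZ hY), one_mul]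
  have h30 := hWN.2 hWn (by rw [hW]; exact K.mul_mem (K.star_mem (K.mul_mem hZ hY)) hgK)
  exact ⟨Z, hZm, hZN.1, Y, hYl, hYN.1, by rw [h30, exp_zero, mul_one]⟩

end OrthGroup

/-! ### Isotropy groups and slices of orbits. -/

namespace OrthGroup

variable {K H : OrthGroup V} {a b : V →L[ℝ] V} {p : V}

/-- The isotropy group of a vector. -/
def stab (K : OrthGroup V) (p : V) : OrthGroup V where
  carrier := {a | a ∈ K ∧ a p = p}
  one_mem' := ⟨K.one_mem, by simp⟩
  mul_mem' := fun {a b} ha hb => ⟨K.mul_mem ha.1 hb.1, by simp [hb.2, ha.2]⟩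
  star_mem' := fun {a} ha => ⟨K.star_mem ha.1, star_eq_of_apply_eq ha.1 ha.2⟩
  star_mul' := fun {a} ha => K.star_mul ha.1
  isCompact' := by
    refine K.isCompact.inter_right (t := {a : V →L[ℝ] V | a p = p}) ?_
    exact isClosed_eq (ContinuousLinearMap.apply ℝ V p).continuous continuous_const

/-- The identity component. -/
def comp (K : OrthGroup V) : OrthGroup V where
  carrier := connectedComponentIn (K : Set (V →L[ℝ] V)) 1
  one_mem' := mem_connectedComponentIn K.one_mem
  mul_mem' := by
    intro a b ha hb
    have haK := connectedComponentIn_subset _ _ ha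
    have h1 : IsPreconnected ((fun c => a * c) '' connectedComponentIn (K : Set (V →L[ℝ] V)) 1) :=
      isPreconnected_connectedComponentIn.image _ (continuous_const_mul a).continuousOn
    have h2 := h1.subset_connectedComponentIn (x := a) (F := K)
      ⟨1, mem_connectedComponentIn K.one_mem, mul_one a⟩ (by
        rintro _ ⟨c, hc, rfl⟩
        exact K.mul_mem haK (connectedComponentIn_subset _ _ hc))
    rw [connectedComponentIn_eq ha]
    exact h2 ⟨b, hb, rfl⟩
  star_mem' := by
    intro a ha
    have h1 : IsPreconnected (star '' connectedComponentIn (K : Set (V →L[ℝ] V)) 1) :=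
      isPreconnected_connectedComponentIn.image _ continuous_star.continuousOn
    exact h1.subset_connectedComponentIn (x := 1) (F := K)
      ⟨1, mem_connectedComponentIn K.one_mem, star_one _⟩ (by
        rintro _ ⟨c, hc, rfl⟩
        exact K.star_mem (connectedComponentIn_subset _ _ hc)) ⟨a, ha, rfl⟩
  star_mul' := fun {a} ha => K.star_mul (connectedComponentIn_subset _ _ ha)
  isCompact' := K.isCompact.of_isClosed_subset
    (isClosed_of_closure_subset <|
      isPreconnected_connectedComponentIn.closure.subset_connectedComponentIn
        (subset_closure (mem_connectedComponentIn K.one_mem))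
        (K.isClosed.closure_subset_iff.2 (connectedComponentIn_subset _ _)))
    (connectedComponentIn_subset _ _)

theorem comp_subset : (K.comp : Set (V →L[ℝ] V)) ⊆ K := connectedComponentIn_subset _ _

theorem isPreconnected_comp : IsPreconnected (K.comp : Set (V →L[ℝ] V)) :=
  isPreconnected_connectedComponentIn

theorem subset_comp {s : Set (V →L[ℝ] V)} (hs : IsPreconnected s) (h1 : 1 ∈ s)
    (hK : s ⊆ K) : s ⊆ K.comp := hs.subset_connectedComponentIn h1 hK

theorem isPreconnected_range_exp_smul (X : V →L[ℝ] V) :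
    IsPreconnected (range fun t : ℝ => exp (t • X)) :=
  isPreconnected_range (exp_continuous_real.comp (by fun_prop))

theorem lie_comp : K.comp.lie = K.lie := by
  refine le_antisymm (lie_mono comp_subset) fun X hX t => ?_
  exact subset_comp (isPreconnected_range_exp_smul X) ⟨0, by simp⟩
    (by rintro _ ⟨t, rfl⟩; exact hX t) ⟨t, rfl⟩

/-- The operators that fix a vector are stable under exponentials of operators that kill it. -/
theorem exp_smul_apply_of_apply_eq_zero {X : V →L[ℝ] V} (h : X p = 0) (t : ℝ) :
    exp (t • X) p = p := by
  have hd : ∀ t : ℝ, HasDerivAt (fun u : ℝ => exp (u • X) p) 0 t := fun t => by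
    have := ((ContinuousLinearMap.apply ℝ V p).hasFDerivAt).comp_hasDerivAt t
      (hasDerivAt_exp_smul_const (𝕂 := ℝ) X t)
    refine this.congr_deriv ?_
    simp [h]
  have := is_const_of_deriv_eq_zero (fun t => (hd t).differentiableAt) (fun t => (hd t).deriv) t 0
  simpa using this

theorem mem_lie_stab {X : V →L[ℝ] V} : X ∈ (K.stab p).lie ↔ X ∈ K.lie ∧ X p = 0 := by
  refine ⟨fun h => ⟨fun t => (h t).1, ?_⟩, fun h t =>
    ⟨h.1 t, exp_smul_apply_of_apply_eq_zero h.2 t⟩⟩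
  have h1 := hasDerivAt_exp_smul_apply X p
  have h2 : (fun t : ℝ => exp (t • X) p) = fun _ => p := funext fun t => (h t).2
  rw [h2] at h1
  exact h1.unique (hasDerivAt_const _ _)

/-- The identity component of the isotropy group. -/
def stab0 (K : OrthGroup V) (p : V) : OrthGroup V := (K.stab p).comp

theorem stab0_subset_stab : (K.stab0 p : Set (V →L[ℝ] V)) ⊆ K.stab p := comp_subset

theorem mem_of_mem_stab0 (h : a ∈ K.stab0 p) : a ∈ K := (stab0_subset_stab h).1

theorem apply_of_mem_stab0 (h : a ∈ K.stab0 p) : a p = p := (stab0_subset_stab h).2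

theorem mem_lie_stab0 {X : V →L[ℝ] V} : X ∈ (K.stab0 p).lie ↔ X ∈ K.lie ∧ X p = 0 := by
  rw [stab0, lie_comp, mem_lie_stab]

theorem isPreconnected_stab0 : IsPreconnected (K.stab0 p : Set (V →L[ℝ] V)) := isPreconnected_comp

theorem stab0_mono (h : (H : Set (V →L[ℝ] V)) ⊆ K) :
    (H.stab0 p : Set (V →L[ℝ] V)) ⊆ K.stab0 p :=
  subset_comp isPreconnected_stab0 one_mem fun _ ha => ⟨h (mem_of_mem_stab0 ha),
    apply_of_mem_stab0 ha⟩

theorem conj_mem_stab0 (hb : b ∈ K) (ha : a ∈ K.stab0 p) : b * a * star b ∈ K.stab0 (b p) := by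
  have h1 : IsPreconnected ((fun c => b * c * star b) '' (K.stab0 p : Set (V →L[ℝ] V))) :=
    isPreconnected_stab0.image _ (by fun_prop)
  refine subset_comp h1 ⟨1, one_mem, by simp [K.mul_star hb]⟩ ?_ ⟨a, ha, rfl⟩
  rintro _ ⟨c, hc, rfl⟩
  refine ⟨K.mul_mem (K.mul_mem hb (mem_of_mem_stab0 hc)) (K.star_mem hb), ?_⟩
  simp only [mul_apply_eq_comp, star_apply_apply hb, apply_of_mem_stab0 hc]

/-- A connected group is contained in any closed group that contains its elements near `1`. -/
theorem subset_of_eventually (hK : IsPreconnected (K : Set (V →L[ℝ] V)))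
    (h : ∀ᶠ g in 𝓝 (1 : V →L[ℝ] V), g ∈ K → g ∈ H) : (K : Set (V →L[ℝ] V)) ⊆ H := by
  have := isPreconnected_iff_preconnectedSpace.1 hK
  let s : Set (K : Set (V →L[ℝ] V)) := {k | (k : V →L[ℝ] V) ∈ H}
  have hs : IsClopen s := by
    refine ⟨H.isClosed.preimage continuous_subtype_val, isOpen_iff_mem_nhds.2 fun k hk => ?_⟩
    have h1 : Tendsto (fun g : (K : Set (V →L[ℝ] V)) => star (k : V →L[ℝ] V) * g) (𝓝 k) (𝓝 1) := by
      have : Continuous fun g : (K : Set (V →L[ℝ] V)) => star (k : V →L[ℝ] V) * g := by fun_prop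
      have h2 := this.tendsto k
      rwa [K.star_mul k.2] at h2
    filter_upwards [h1.eventually h] with g hg
    have h3 := H.mul_mem hk (hg (K.mul_mem (K.star_mem k.2) g.2))
    rwa [← mul_assoc, K.mul_star k.2, one_mul] at h3
  have huniv : s = univ := hs.eq_univ ⟨⟨1, K.one_mem⟩, H.one_mem⟩
  intro k hk
  have : (⟨k, hk⟩ : (K : Set (V →L[ℝ] V))) ∈ s := huniv ▸ mem_univ _
  exact this

/-- A connected group fixes the vectors killed by its Lie algebra. -/
theorem apply_eq_of_lie_apply_eq_zero (hK : IsPreconnected (K : Set (V →L[ℝ] V)))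
    (h : ∀ X ∈ K.lie, X p = 0) {k : V →L[ℝ] V} (hk : k ∈ K) : k p = p := by
  refine (subset_of_eventually (H := K.stab p) hK ?_ hk).2
  filter_upwards [eventually_exists_exp_mul_exp (K := K) (l := K.lie) (m := ⊥) (by simp)
    univ_mem] with g hg hgK
  obtain ⟨Z, hZ, -, Y, hY, -, rfl⟩ := hg hgK
  rw [Submodule.mem_bot] at hZ
  refine ⟨hgK, ?_⟩
  have := exp_smul_apply_of_apply_eq_zero (h Y hY) 1
  rw [one_smul] at this
  simp [hZ, this]

/-- The tangent space of the orbit of `p` at `p`. -/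
noncomputable def tang (K : OrthGroup V) (p : V) : Submodule ℝ V :=
  K.lie.map (ContinuousLinearMap.apply ℝ V p : (V →L[ℝ] V) →L[ℝ] V).toLinearMap

theorem mem_tang {v : V} : v ∈ K.tang p ↔ ∃ X ∈ K.lie, X p = v := by
  simp [tang]

theorem apply_mem_tang {X : V →L[ℝ] V} (hX : X ∈ K.lie) : X p ∈ K.tang p := mem_tang.2 ⟨X, hX, rfl⟩

theorem mem_tang_orthogonal {v : V} :
    v ∈ (K.tang p)ᗮ ↔ ∀ X ∈ K.lie, inner ℝ v (X p) = 0 := by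
  rw [Submodule.mem_orthogonal']
  exact ⟨fun h X hX => h _ (apply_mem_tang hX), fun h w hw => by
    obtain ⟨X, hX, rfl⟩ := mem_tang.1 hw; exact h X hX⟩

theorem apply_mem_tang_orthogonal {v : V} (hb : b ∈ K) (hv : v ∈ (K.tang p)ᗮ) :
    b v ∈ (K.tang (b p))ᗮ := by
  rw [mem_tang_orthogonal] at hv ⊢
  intro X hX
  have h1 := hv _ (conj_mem_lie (K.star_mem hb) hX)
  rw [← inner_apply_apply hb] at h1
  simpa [apply_star_apply hb] using h1

theorem mem_tang_orthogonal_self (K : OrthGroup V) (p : V) : p ∈ (K.tang p)ᗮ := by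
  rw [mem_tang_orthogonal]
  intro X hX
  have := inner_lie hX p p
  rw [real_inner_comm] at this
  linarith

/-- Inverse function theorem: by the product rule the derivative at `0` is the invertible map `L`.
-/
theorem exists_homeomorph_exp_apply {E : Type*} [NormedAddCommGroup E] [NormedSpace ℝ E]
    [CompleteSpace E] (p1 : E →L[ℝ] V →L[ℝ] V) (p2 : E →L[ℝ] V) (p : V) (L : E ≃L[ℝ] V)
    (hL : ∀ z, L z = p1 z p + p2 z) : ∃ φ : OpenPartialHomeomorph E V,
      (∀ z, φ z = exp (p1 z) (p + p2 z)) ∧ 0 ∈ φ.source := by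
  have hΦ : HasStrictFDerivAt (fun z => exp (p1 z) (p + p2 z)) (L : E →L[ℝ] V) 0 := by
    have h0 : HasStrictFDerivAt (exp : (V →L[ℝ] V) → _) (ContinuousLinearMap.id ℝ _) (p1 0) := by
      rw [map_zero]; exact hasStrictFDerivAt_exp_zero_id
    have h1 : HasStrictFDerivAt (fun z => exp (p1 z)) p1 0 :=
      h0.comp (0 : E) p1.hasStrictFDerivAt
    have h2 : HasStrictFDerivAt (fun z => p + p2 z) p2 0 := p2.hasStrictFDerivAt.const_add p
    refine (h1.clm_apply h2).congr_fderiv ?_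
    ext z
    simp [hL, add_comm]
  exact ⟨hΦ.toOpenPartialHomeomorph _, fun z => rfl, hΦ.mem_toOpenPartialHomeomorph_source⟩

/-- The map `(Z, x) ↦ exp Z x` is a local homeomorphism from a complement of the isotropy algebra
times the normal space of the orbit. -/
theorem exists_slice_homeomorph (K : OrthGroup V) (p : V) : ∃ m : Submodule ℝ (V →L[ℝ] V),
    (K.stab0 p).lie ⊔ m = K.lie ∧ ∃ φ : OpenPartialHomeomorph (m × (K.tang p)ᗮ) V,
      (∀ z, φ z = exp (z.1 : V →L[ℝ] V) (p + z.2 : V)) ∧ 0 ∈ φ.source := by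
  obtain ⟨m₀, hm₀⟩ := Submodule.exists_isCompl (K.stab0 p).lie
  have hle : (K.stab0 p).lie ≤ K.lie := fun X hX => (mem_lie_stab0.1 hX).1
  let m : Submodule ℝ (V →L[ℝ] V) := m₀ ⊓ K.lie
  have hsup : (K.stab0 p).lie ⊔ m = K.lie := by
    rw [← sup_inf_assoc_of_le _ hle, hm₀.sup_eq_top, top_inf_eq]
  have hinf : ∀ Z ∈ m, Z p = 0 → Z = 0 := fun Z hZ h => by
    have : Z ∈ (K.stab0 p).lie ⊓ m₀ := ⟨mem_lie_stab0.2 ⟨hZ.2, h⟩, hZ.1⟩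
    rwa [hm₀.inf_eq_bot, Submodule.mem_bot] at this
  let N := (K.tang p)ᗮ
  let p1 : m × N →L[ℝ] (V →L[ℝ] V) := m.subtypeL ∘L .fst ℝ _ _
  let p2 : m × N →L[ℝ] V := N.subtypeL ∘L .snd ℝ _ _
  let L : m × N →L[ℝ] V := (ContinuousLinearMap.apply ℝ V p : (V →L[ℝ] V) →L[ℝ] V) ∘L p1 + p2
  have hL : ∀ z, L z = (z.1 : V →L[ℝ] V) p + z.2 := fun z => rfl
  have hinj : Function.Injective L := by
    rw [injective_iff_map_eq_zero]
    rintro ⟨Z, x⟩ hz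
    rw [hL] at hz
    have hxt : inner ℝ (x : V) ((Z : V →L[ℝ] V) p) = 0 := mem_tang_orthogonal.1 x.2 _ Z.2.2
    have hZ0 : (Z : V →L[ℝ] V) p = 0 := by
      rw [← inner_self_eq_zero (𝕜 := ℝ)]
      have := congrArg (fun v => inner ℝ v ((Z : V →L[ℝ] V) p)) hz
      simpa [inner_add_left, hxt] using this
    have hx0 : (x : V) = 0 := by simpa [hZ0] using hz
    exact Prod.ext (Subtype.ext (hinf Z Z.2 hZ0)) (Subtype.ext hx0)
  have hsurj : Function.Surjective L := by
    intro v
    have hv : v ∈ K.tang p ⊔ (K.tang p)ᗮ := by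
      rw [Submodule.sup_orthogonal_of_hasOrthogonalProjection]; trivial
    obtain ⟨w, hw, x, hx, rfl⟩ := Submodule.mem_sup.1 hv
    obtain ⟨X, hX, rfl⟩ := mem_tang.1 hw
    rw [← hsup] at hX
    obtain ⟨Y, hY, Z, hZ, rfl⟩ := Submodule.mem_sup.1 hX
    refine ⟨(⟨Z, hZ⟩, ⟨x, hx⟩), ?_⟩
    rw [hL]
    simp [(mem_lie_stab0.1 hY).2]
  let Le : (m × N) ≃L[ℝ] V :=
    (LinearEquiv.ofBijective L.toLinearMap ⟨hinj, hsurj⟩).toContinuousLinearEquiv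
  have : CompleteSpace (m × N) := FiniteDimensional.complete ℝ _
  obtain ⟨φ, hφ, h0⟩ := exists_homeomorph_exp_apply p1 p2 p Le fun z => hL z
  exact ⟨m, hsup, φ, hφ, h0⟩

/-- Group elements near `1` that map a point of a slice to the slice belong to the identity
component of the isotropy group. -/
theorem eventually_mem_stab0 (K : OrthGroup V) (p : V) :
    ∀ᶠ z in 𝓝 ((1 : V →L[ℝ] V), p), z.1 ∈ K → z.2 ∈ (K.tang p)ᗮ → z.1 z.2 ∈ (K.tang p)ᗮ →
      z.1 ∈ K.stab0 p := by
  obtain ⟨m, hm, φ, hφ, h0⟩ := K.exists_slice_homeomorph p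
  obtain ⟨δ, hδ, hball⟩ := Metric.mem_nhds_iff.1 (φ.open_source.mem_nhds h0)
  have hN : Metric.ball (0 : V →L[ℝ] V) δ ∈ 𝓝 0 := Metric.ball_mem_nhds _ hδ
  have h1 := eventually_exists_exp_mul_exp hm hN
  have hcont : Continuous fun z : (V →L[ℝ] V) × V => z.1 z.2 := by fun_prop
  have h2 : ∀ᶠ z in 𝓝 ((1 : V →L[ℝ] V), p), z.1 z.2 ∈ Metric.ball p δ :=
    hcont.continuousAt (Metric.isOpen_ball.mem_nhds (by simpa using hδ))
  have h3 : ∀ᶠ z in 𝓝 ((1 : V →L[ℝ] V), p), z.2 ∈ Metric.ball p δ :=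
    continuous_snd.continuousAt (Metric.ball_mem_nhds _ hδ)
  have h4 := (continuous_fst (X := V →L[ℝ] V) (Y := V)).continuousAt (x := ((1 : V →L[ℝ] V), p))
    |>.eventually h1
  filter_upwards [h2, h3, h4] with z hz2 hz3 hz4 hzK hx hgx
  have hp := mem_tang_orthogonal_self K p
  obtain ⟨Z, hZ, hZδ, Y, hY, -, hg⟩ := hz4 hzK
  have hYs : exp Y ∈ K.stab0 p := exp_mem hY
  set x' := exp Y z.2 with hx'
  have hgx' : z.1 z.2 = exp Z x' := by rw [hg]; simp [hx']
  have hx'N : x' ∈ (K.tang p)ᗮ := by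
    have := apply_mem_tang_orthogonal (mem_of_mem_stab0 hYs) hx
    rwa [apply_of_mem_stab0 hYs] at this
  have hx'δ : ‖x' - p‖ < δ := by
    have : x' - p = exp Y (z.2 - p) := by rw [map_sub, apply_of_mem_stab0 hYs]
    rw [this, norm_apply hYs, ← dist_eq_norm]
    exact hz3
  -- The slice chart takes the value `z.1 z.2` at both `z1` and `z2`. Injectivity gives `Z = 0`, so
  -- the group element is `exp Y`.
  let z1 : m × (K.tang p)ᗮ := (⟨Z, hZ⟩, ⟨x' - p, sub_mem hx'N hp⟩)
  let z2 : m × (K.tang p)ᗮ := (0, ⟨z.1 z.2 - p, sub_mem hgx hp⟩)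
  have hz1 : z1 ∈ φ.source := hball (by
    rw [mem_ball_zero_iff, Prod.norm_def, max_lt_iff]
    exact ⟨mem_ball_zero_iff.1 hZδ, hx'δ⟩)
  have hz2 : z2 ∈ φ.source := hball (by
    rw [mem_ball_zero_iff, Prod.norm_def, max_lt_iff]
    exact ⟨by simpa [z2] using hδ, by rw [← mem_ball_iff_norm] at *; exact mem_ball_iff_norm.1 hz2⟩)
  have heq : φ z1 = φ z2 := by
    rw [hφ, hφ]
    simp [z1, z2, hgx']
  have := congrArg (fun z => (z.1 : V →L[ℝ] V)) (φ.injOn hz1 hz2 heq)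
  have hZ0 : Z = 0 := this
  rw [hg, hZ0, exp_zero, one_mul]
  exact hYs

/-- Every point near `p` can be moved into the slice by a group element near `1`. -/
theorem eventually_exists_apply_mem_slice (K : OrthGroup V) (p : V)
    {W : Set (V →L[ℝ] V)} (hW : W ∈ 𝓝 (1 : V →L[ℝ] V)) :
    ∀ᶠ v in 𝓝 p, ∃ a ∈ K, a ∈ W ∧ a v ∈ (K.tang p)ᗮ := by
  obtain ⟨m, hm, φ, hφ, h0⟩ := K.exists_slice_homeomorph p
  have hφ0 : φ 0 = p := by simp [hφ]
  have h1 := φ.symm.continuousAt (x := φ 0) (by simpa using φ.map_source h0)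
  have h1' : Tendsto φ.symm (𝓝 p) (𝓝 0) := by
    have := h1.tendsto
    rwa [φ.left_inv h0, hφ0] at this
  have h2 : ∀ᶠ v in 𝓝 p, v ∈ φ.target := φ.open_target.mem_nhds (by
    have := φ.map_source h0
    rwa [hφ0] at this)
  have hc : Continuous fun z : m × (K.tang p)ᗮ => exp (-(z.1 : V →L[ℝ] V)) :=
    exp_continuous_real.comp (by fun_prop)
  have h3 : ∀ᶠ z in 𝓝 (0 : m × (K.tang p)ᗮ), exp (-(z.1 : V →L[ℝ] V)) ∈ W :=
    hc.continuousAt (by simpa using hW)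
  filter_upwards [h2, h1'.eventually h3] with v hv hvW
  have hmK : m ≤ K.lie := hm ▸ le_sup_right
  refine ⟨_, exp_mem (K.lie.neg_mem (hmK (φ.symm v).1.2)), hvW, ?_⟩
  have h4 : exp (-((φ.symm v).1 : V →L[ℝ] V)) v = p + (φ.symm v).2 := by
    have : exp (-((φ.symm v).1 : V →L[ℝ] V)) (exp ((φ.symm v).1 : V →L[ℝ] V)
        (p + (φ.symm v).2 : V)) = p + (φ.symm v).2 := by
      rw [← mul_apply_eq_comp, exp_neg_mul_exp, one_apply_eq_self]
    rwa [← hφ, φ.right_inv hv] at this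
  rw [h4]
  exact add_mem (mem_tang_orthogonal_self K p) (φ.symm v).2.2

/-- Isotropy groups of points of the slice are contained in the isotropy group of its center. -/
theorem eventually_stab0_subset (K : OrthGroup V) (p : V) :
    ∀ᶠ x in 𝓝 p, x ∈ (K.tang p)ᗮ → (K.stab0 x : Set (V →L[ℝ] V)) ⊆ K.stab0 p := by
  have h := K.eventually_mem_stab0 p
  rw [nhds_prod_eq, prod_comm, eventually_map] at h
  -- Currying lets the neighbourhood of `1` depend on `x`. This is enough, since the connected group
  -- `K.stab0 x` is determined by its elements near `1`.
  filter_upwards [h.curry] with x hx hxN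
  refine subset_of_eventually isPreconnected_stab0 ?_
  filter_upwards [hx] with g hg hgx
  have h1 := apply_of_mem_stab0 hgx
  exact hg (mem_of_mem_stab0 hgx) hxN (by simpa [h1] using hxN)

/-- The identity components of isotropy groups are upper semicontinuous. -/
theorem isClosed_setOf_mem_stab0 (K : OrthGroup V) :
    IsClosed {z : V × (V →L[ℝ] V) | z.2 ∈ K.stab0 z.1} := by
  refine isClosed_of_closure_subset ?_
  rintro ⟨p, h⟩ hcl
  change h ∈ (K.stab0 p : Set (V →L[ℝ] V))
  rw [← (K.stab0 p).isClosed.closure_eq]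
  rw [mem_closure_iff_nhds] at hcl ⊢
  intro O hO
  have hconj : Continuous fun z : (V →L[ℝ] V) × (V →L[ℝ] V) => z.1 * z.2 * star z.1 := by fun_prop
  have h1 : ∀ᶠ z in 𝓝 (1 : V →L[ℝ] V) ×ˢ 𝓝 h, z.1 * z.2 * star z.1 ∈ O := by
    rw [← nhds_prod_eq]
    exact hconj.continuousAt (by simpa using hO)
  obtain ⟨W, hW, O', hO', hWO⟩ := eventually_prod_iff.1 h1
  have happ : Continuous fun z : (V →L[ℝ] V) × V => z.1 z.2 := by fun_prop
  have h2 : ∀ᶠ z in 𝓝 (1 : V →L[ℝ] V) ×ˢ 𝓝 p, z.2 ∈ {x | x ∈ (K.tang p)ᗮ →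
      (K.stab0 x : Set (V →L[ℝ] V)) ⊆ K.stab0 p} ∧ z.1 z.2 ∈ {x | x ∈ (K.tang p)ᗮ →
      (K.stab0 x : Set (V →L[ℝ] V)) ⊆ K.stab0 p} := by
    rw [← nhds_prod_eq]
    refine ((continuous_snd.continuousAt (x := ((1 : V →L[ℝ] V), p))).eventually
      (K.eventually_stab0_subset p)).and ((happ.continuousAt).eventually ?_)
    simpa using K.eventually_stab0_subset p
  obtain ⟨W', hW', P', hP', hWP⟩ := eventually_prod_iff.1 h2
  -- For `(v, g)` close to `(p, h)` with `g` in the isotropy component of `v`, move `v` into the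
  -- slice by `a` close to `1`. Then `a * g * star a` is close to `h` and belongs to `K.stab0 p`.
  have h3 := K.eventually_exists_apply_mem_slice p (hW.and hW')
  obtain ⟨⟨v, g⟩, hvg, hg⟩ := hcl ({v | P' v ∧ ∃ a ∈ K, a ∈ {a | W a ∧ W' a} ∧
    a v ∈ (K.tang p)ᗮ} ×ˢ {g | O' g}) (prod_mem_nhds (hP'.and h3) hO')
  obtain ⟨⟨hv, a, haK, ha, hav⟩, hg'⟩ := hvg
  exact ⟨a * g * star a, hWO ha.1 hg', (hWP ha.2 hv).2 hav (conj_mem_stab0 haK hg)⟩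

end OrthGroup

/-! ### Polar actions, their slice representations and the chamber. -/

namespace OrthGroup

variable {K H : OrthGroup V} {a b k : V →L[ℝ] V} {X Z : V →L[ℝ] V} {U : Submodule ℝ V}
  {p s t u v y : V}

/-- The normal space in `U` of the orbit of `p` at `p`. -/
noncomputable def nu (K : OrthGroup V) (U : Submodule ℝ V) (p : V) : Submodule ℝ V :=
  U ⊓ (K.tang p)ᗮ

theorem mem_nu : v ∈ K.nu U p ↔ v ∈ U ∧ ∀ X ∈ K.lie, inner ℝ v (X p) = 0 := by
  rw [nu, Submodule.mem_inf, mem_tang_orthogonal]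

/-- The connected group `K` acts on `U`, and the normal space at `y ∈ U` of the orbit of `y` meets
all orbits orthogonally; this normal space is then a section and `y` is a regular point. -/
structure IsPolarAt (K : OrthGroup V) (U : Submodule ℝ V) (y : V) : Prop where
  isPreconnected : IsPreconnected (K : Set (V →L[ℝ] V))
  apply_mem : ∀ k ∈ K, ∀ u ∈ U, k u ∈ U
  base_mem : y ∈ U
  inner_apply : ∀ X ∈ K.lie, ∀ s ∈ K.nu U y, ∀ t ∈ K.nu U y, inner ℝ (X s) t = 0

/-- The closed chamber of the section `K.nu U y` that contains `y`. -/
def chamber (K : OrthGroup V) (U : Submodule ℝ V) (y : V) : Set V :=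
  {s | s ∈ K.nu U y ∧ ∀ X ∈ K.lie, 0 ≤ inner ℝ (X s) (X y)}

theorem add_mem_chamber (hs : s ∈ K.chamber U y) (ht : t ∈ K.chamber U y) :
    s + t ∈ K.chamber U y :=
  ⟨add_mem hs.1 ht.1, fun X hX => by
    rw [map_add, inner_add_left]; exact add_nonneg (hs.2 X hX) (ht.2 X hX)⟩

theorem smul_mem_chamber {c : ℝ} (hc : 0 ≤ c) (hs : s ∈ K.chamber U y) :
    c • s ∈ K.chamber U y :=
  ⟨Submodule.smul_mem _ _ hs.1, fun X hX => by
    rw [map_smul, real_inner_smul_left]; exact mul_nonneg hc (hs.2 X hX)⟩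

theorem convex_chamber : Convex ℝ (K.chamber U y) := fun _ hs _ ht _ _ ha hb _ =>
  add_mem_chamber (smul_mem_chamber ha hs) (smul_mem_chamber hb ht)

theorem isClosed_chamber : IsClosed (K.chamber U y) := by
  have : K.chamber U y = (K.nu U y : Set V) ∩ ⋂ X ∈ K.lie, {s | 0 ≤ inner ℝ (X s) (X y)} := by
    ext s; simp [chamber]
  rw [this]
  refine (Submodule.closed_of_finiteDimensional _).inter (isClosed_biInter fun X _ => ?_)
  exact isClosed_le continuous_const (by fun_prop)

theorem nu_invariant (hU : ∀ k ∈ K, ∀ u ∈ U, k u ∈ U) (hb : b ∈ K) (hbp : b p = p)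
    (hv : v ∈ K.nu U p) : b v ∈ K.nu U p := by
  refine ⟨hU b hb v hv.1, ?_⟩
  have := apply_mem_tang_orthogonal hb hv.2
  rwa [hbp] at this

namespace IsPolarAt

variable (h : IsPolarAt K U y)
include h

theorem lie_apply_mem (hX : X ∈ K.lie) (hu : u ∈ U) : X u ∈ U :=
  mem_of_hasDerivAt (Submodule.closed_of_finiteDimensional U) (hasDerivAt_exp_smul_apply X u)
    fun t => h.apply_mem _ (hX t) _ hu

theorem base_mem_nu : y ∈ K.nu U y := ⟨h.base_mem, mem_tang_orthogonal_self K y⟩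

theorem base_mem_chamber : y ∈ K.chamber U y :=
  ⟨h.base_mem_nu, fun _ _ => real_inner_self_nonneg⟩

/-- Polarity applied to the bracket, combined with skew-symmetry of `X` and `Z`. For `t = y` it
makes `(X, Z) ↦ ⟪X s, Z y⟫` a symmetric bilinear form for each `s` in the section. -/
theorem inner_lie_comm (hX : X ∈ K.lie) (hZ : Z ∈ K.lie) (hs : s ∈ K.nu U y)
    (ht : t ∈ K.nu U y) : inner ℝ (X s) (Z t) = inner ℝ (Z s) (X t) := by
  have h1 := h.inner_apply _ (bracket_mem_lie hX hZ) s hs t ht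
  simp only [sub_apply, mul_apply_eq_comp, inner_sub_left] at h1
  rw [inner_lie hX (Z s) t, inner_lie hZ (X s) t] at h1
  linarith

theorem apply_eq_zero_of_mem (hX : X ∈ K.lie) (hs : s ∈ K.nu U y) (hXs : X s ∈ K.nu U y) :
    X s = 0 := by
  rw [← inner_self_eq_zero (𝕜 := ℝ)]
  exact h.inner_apply X hX s hs _ hXs

/-- This is the regularity of `y`: by the symmetry of the form, `X s` is normal to the orbit of `y`,
hence lies in the section, to which it is also orthogonal. -/
theorem apply_eq_zero (hX : X ∈ K.lie) (hXy : X y = 0) (hs : s ∈ K.nu U y) : X s = 0 := by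
  refine h.apply_eq_zero_of_mem hX hs (mem_nu.2 ⟨h.lie_apply_mem hX hs.1, fun Z hZ => ?_⟩)
  rw [h.inner_lie_comm hX hZ hs h.base_mem_nu, hXy, inner_zero_right]

theorem exists_add (hu : u ∈ U) : ∃ X ∈ K.lie, ∃ s ∈ K.nu U y, u = X y + s := by
  have hv : u ∈ K.tang y ⊔ (K.tang y)ᗮ := by
    rw [Submodule.sup_orthogonal_of_hasOrthogonalProjection]; trivial
  obtain ⟨w, hw, s, hs, rfl⟩ := Submodule.mem_sup.1 hv
  obtain ⟨X, hX, rfl⟩ := mem_tang.1 hw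
  refine ⟨X, hX, s, ⟨?_, hs⟩, rfl⟩
  have := U.sub_mem hu (h.lie_apply_mem hX h.base_mem)
  rwa [add_sub_cancel_left] at this

theorem mem_nu_of_mem (hp : p ∈ K.nu U y) (hs : s ∈ K.nu U y) : s ∈ K.nu U p :=
  mem_nu.2 ⟨hs.1, fun X hX => by rw [real_inner_comm]; exact h.inner_apply X hX p hp s hs⟩

/-- The slice representation has the same section. -/
theorem nu_stab0 (hp : p ∈ K.nu U y) : (K.stab0 p).nu (K.nu U p) y = K.nu U y := by
  ext u
  refine ⟨fun hu => ?_, fun hs => mem_nu.2 ⟨h.mem_nu_of_mem hp hs, fun X hX =>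
    (mem_nu.1 hs).2 X (mem_lie_stab0.1 hX).1⟩⟩
  obtain ⟨hup, huy⟩ := mem_nu.1 hu
  obtain ⟨X, hX, s, hs, hu'⟩ := h.exists_add hup.1
  -- By symmetry `⟪X p, Z y⟫ = ⟪Z p, X y⟫`, and `X y = u - s` is normal to the orbit of `p`. So `X
  -- p` lies in the section, to which it is orthogonal.
  have hXp : X p = 0 := by
    refine h.apply_eq_zero_of_mem hX hp (mem_nu.2 ⟨h.lie_apply_mem hX hp.1, fun Z hZ => ?_⟩)
    rw [h.inner_lie_comm hX hZ hp h.base_mem_nu, real_inner_comm]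
    have h1 : X y = u - s := by rw [hu', add_sub_cancel_right]
    rw [h1]
    exact (mem_nu.1 (sub_mem hup (h.mem_nu_of_mem hp hs))).2 Z hZ
  -- Now `X` belongs to the isotropy algebra of `p`, so `u` is orthogonal to `X y`; its component `X
  -- y` must vanish.
  have h2 := huy X (mem_lie_stab0.2 ⟨hX, hXp⟩)
  rw [hu', inner_add_left, (mem_nu.1 hs).2 X hX, add_zero, inner_self_eq_zero] at h2
  rw [hu', h2, zero_add]
  exact hs

/-- The slice representation at a point of the section is polar. -/
theorem slice (hp : p ∈ K.nu U y) : IsPolarAt (K.stab0 p) (K.nu U p) y where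
  isPreconnected := isPreconnected_stab0
  apply_mem k hk u hu := nu_invariant h.apply_mem (mem_of_mem_stab0 hk) (apply_of_mem_stab0 hk) hu
  base_mem := h.mem_nu_of_mem hp h.base_mem_nu
  inner_apply X hX s hs t ht := by
    rw [h.nu_stab0 hp] at hs ht
    exact h.inner_apply X (mem_lie_stab0.1 hX).1 s hs t ht

theorem chamber_subset_slice (hp : p ∈ K.nu U y) :
    K.chamber U y ⊆ (K.stab0 p).chamber (K.nu U p) y := fun s hs =>
  ⟨by rw [h.nu_stab0 hp]; exact hs.1, fun X hX => hs.2 X (mem_lie_stab0.1 hX).1⟩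

-- A linear right inverse of the evaluation `X ↦ X y`. It expresses conditions over the Lie algebra
-- as conditions on tangent vectors, where the unit sphere is compact.
omit h in
theorem exists_lift (K : OrthGroup V) (y : V) : ∃ R : V →L[ℝ] V →L[ℝ] V,
    (∀ w, R w ∈ K.lie) ∧ ∀ X ∈ K.lie, R (X y) y = X y := by
  let f : K.lie →ₗ[ℝ] K.tang y :=
    { toFun := fun X => ⟨(X : V →L[ℝ] V) y, apply_mem_tang X.2⟩
      map_add' := fun _ _ => rfl
      map_smul' := fun _ _ => rfl }
  have hf : f.range = ⊤ := by
    rw [LinearMap.range_eq_top]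
    rintro ⟨w, hw⟩
    obtain ⟨X, hX, rfl⟩ := mem_tang.1 hw
    exact ⟨⟨X, hX⟩, rfl⟩
  obtain ⟨g, hg⟩ := f.exists_rightInverse_of_surjective hf
  let R₀ : V →ₗ[ℝ] V →L[ℝ] V :=
    K.lie.subtype ∘ₗ g ∘ₗ ((K.tang y).orthogonalProjectionOnto : V →ₗ[ℝ] K.tang y)
  refine ⟨R₀.toContinuousLinearMap, fun w => (g _).2, fun X hX => ?_⟩
  have h1 : (K.tang y).orthogonalProjectionOnto (X y) = ⟨X y, apply_mem_tang hX⟩ :=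
    Submodule.orthogonalProjectionOnto_mem_subspace_eq_self (K := K.tang y) ⟨X y, apply_mem_tang hX⟩
  have h2 := LinearMap.congr_fun hg ⟨X y, apply_mem_tang hX⟩
  have h3 : R₀ (X y) = g ⟨X y, apply_mem_tang hX⟩ := by
    change ((g ((K.tang y).orthogonalProjectionOnto (X y)) : K.lie) : V →L[ℝ] V) = _
    rw [h1]
  rw [LinearMap.coe_toContinuousLinearMap', h3]
  exact congrArg Subtype.val h2

/-- The difference of `R (X y)` and `X` kills `y`, hence the whole section, so the choice of lift
does not matter there. -/
theorem lift_apply {R : V →L[ℝ] V →L[ℝ] V} (hR : ∀ w, R w ∈ K.lie)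
    (hRy : ∀ X ∈ K.lie, R (X y) y = X y) (hX : X ∈ K.lie) (hs : s ∈ K.nu U y) :
    R (X y) s = X s := by
  have := h.apply_eq_zero (sub_mem (hR (X y)) hX) (by simp [hRy X hX]) hs
  rwa [sub_apply, sub_eq_zero] at this

/-- Near one of its points the chamber coincides with the chamber of the slice representation. -/
theorem eventually_mem_chamber (hp : p ∈ K.chamber U y) :
    ∀ᶠ s in 𝓝 p, s ∈ (K.stab0 p).chamber (K.nu U p) y → s ∈ K.chamber U y := by
  obtain ⟨R, hR, hRy⟩ := exists_lift K y
  have hpS := hp.1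
  have hsl := h.slice hpS
  -- On tangent vectors `Z y` orthogonal to the isotropy directions at `p`, the form `⟪Z p, Z y⟫` is
  -- positive definite. Compactness of the unit sphere keeps it positive at all points `s` near `p`.
  let T : Submodule ℝ V := K.tang y ⊓ ((K.stab0 p).tang y)ᗮ
  have hcomp : IsCompact ((T : Set V) ∩ Metric.sphere 0 1) :=
    (isCompact_sphere (0 : V) 1).inter_left (Submodule.closed_of_finiteDimensional T)
  have hpos : ∀ w ∈ (T : Set V) ∩ Metric.sphere 0 1, 0 < inner ℝ (R w p) w := by
    rintro w ⟨⟨hw, hwp⟩, hw1⟩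
    obtain ⟨Z, hZ, rfl⟩ := mem_tang.1 hw
    rw [h.lift_apply hR hRy hZ hpS]
    refine lt_of_le_of_ne (hp.2 Z hZ) fun h0 => ?_
    have hZp : Z p = 0 := by
      refine h.apply_eq_zero_of_mem hZ hpS (mem_nu.2 ⟨h.lie_apply_mem hZ hpS.1, fun W hW => ?_⟩)
      -- A null vector of a positive semidefinite form lies in its radical. Otherwise `c = -q / (r +
      -- 1)` makes the expansion along `Z + c • W` negative; the shift by `1` covers the case `r =
      -- 0`.
      by_contra hne
      set q := inner ℝ (Z p) (W y) with hq
      set r := inner ℝ (W p) (W y) with hr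
      have hWZ : inner ℝ (W p) (Z y) = q := by
        rw [hq, h.inner_lie_comm hZ hW hpS h.base_mem_nu]
      have key : ∀ c : ℝ, 0 ≤ 2 * c * q + c ^ 2 * r := by
        intro c
        have := hp.2 (Z + c • W) (add_mem hZ (K.lie.smul_mem c hW))
        simp only [add_apply, smul_apply, inner_add_left,
          inner_add_right, real_inner_smul_left, real_inner_smul_right, ← h0, hWZ, ← hq, ← hr]
          at this
        linarith
      have hr0 : 0 ≤ r := hp.2 W hW
      have h1 := key (-q / (r + 1))
      have h2 : 2 * (-q / (r + 1)) * q + (-q / (r + 1)) ^ 2 * r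
          = -(q ^ 2 * (r + 2)) / (r + 1) ^ 2 := by
        field_simp; ring
      rw [h2] at h1
      have h3 : 0 < q ^ 2 * (r + 2) / (r + 1) ^ 2 := by positivity
      rw [neg_div] at h1
      linarith
    have h1 := mem_tang_orthogonal.1 hwp Z (mem_lie_stab0.2 ⟨hZ, hZp⟩)
    rw [inner_self_eq_zero] at h1
    simp [h1] at hw1
  have hcont : Continuous fun z : V × V => inner ℝ (R z.2 z.1) z.2 := by fun_prop
  have hev := hcomp.eventually_forall_of_forall_eventually (x₀ := p)
    (P := fun s w => 0 < inner ℝ (R w s) w) fun w hw =>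
      hcont.continuousAt (lt_mem_nhds (hpos w hw))
  filter_upwards [hev] with s hs hsD
  have hsS : s ∈ K.nu U y := by rw [← h.nu_stab0 hpS]; exact hsD.1
  refine ⟨hsS, fun X hX => ?_⟩
  -- Split `X = Y + Z`, with `Y` in the isotropy algebra of `p` and `Z y` orthogonal to its tangent
  -- directions. The `Y` part is controlled by the slice chamber, the `Z` part by positivity on `T`,
  -- and the cross terms vanish.
  have hdec : X y ∈ (K.stab0 p).tang y ⊔ ((K.stab0 p).tang y)ᗮ := by
    rw [Submodule.sup_orthogonal_of_hasOrthogonalProjection]; trivial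
  obtain ⟨w₁, hw₁, w, hw, hsum⟩ := Submodule.mem_sup.1 hdec
  obtain ⟨Y, hY, rfl⟩ := mem_tang.1 hw₁
  have hYK := (mem_lie_stab0.1 hY).1
  have hZ : X - Y ∈ K.lie := sub_mem hX hYK
  have hw' : w = (X - Y) y := by
    rw [sub_apply, ← hsum, add_sub_cancel_left]
  set Z := X - Y with hZdef
  have hXYZ : X = Y + Z := by rw [hZdef]; abel
  have hwT : w ∈ T := ⟨hw' ▸ apply_mem_tang hZ, hw⟩
  -- Polarity of the slice leaves no normal component in `Y s`: it is tangent to the isotropy orbit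
  -- of `y`, to which `w` is orthogonal.
  have hcross : inner ℝ (Y s) w = 0 := by
    obtain ⟨W, hW, s', hs', hYs⟩ := hsl.exists_add (u := Y s)
      (hsl.lie_apply_mem hY (h.mem_nu_of_mem hpS hsS))
    have hs'S : s' ∈ K.nu U y := by rw [← h.nu_stab0 hpS]; exact hs'
    have : inner ℝ (Y s) s' = 0 := h.inner_apply Y hYK s hsS s' hs'S
    rw [hYs, inner_add_left, real_inner_comm, (mem_nu.1 hs').2 W hW, zero_add,
      inner_self_eq_zero] at this
    rw [hYs, this, add_zero, real_inner_comm]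
    exact mem_tang_orthogonal.1 hw W hW
  have hZZ : 0 ≤ inner ℝ (Z s) w := by
    rcases eq_or_ne w 0 with h0 | h0
    · simp [h0]
    have hn : 0 < ‖w‖ := norm_pos_iff.2 h0
    have h1 := hs (‖w‖⁻¹ • w) ⟨T.smul_mem _ hwT, by simp [norm_smul, hn.ne']⟩
    rw [map_smul, smul_apply, real_inner_smul_left, real_inner_smul_right] at h1
    have h2 : R w s = Z s := by rw [hw']; exact h.lift_apply hR hRy hZ hsS
    rw [h2] at h1
    have hi : 0 < ‖w‖⁻¹ := inv_pos.2 hn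
    exact (pos_of_mul_pos_right (pos_of_mul_pos_right h1 hi.le) hi.le).le
  have hZY : inner ℝ (Z s) (Y y) = 0 := by
    rw [h.inner_lie_comm hZ hYK hsS h.base_mem_nu, ← hw', hcross]
  have hYY : 0 ≤ inner ℝ (Y s) (Y y) := hsD.2 Y hY
  rw [hXYZ]
  simp only [add_apply, inner_add_left, inner_add_right]
  rw [← hw', hcross, hZY]
  linarith

end IsPolarAt

/-- A point of an orbit that is nearest to `y` lies in the normal space of the orbit of `y` and
satisfies the second order condition. -/
theorem mem_chamber_of_isMax (hv : v ∈ U)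
    (hmax : ∀ g ∈ K, inner ℝ (g v) y ≤ inner ℝ v y) : v ∈ K.chamber U y := by
  refine ⟨mem_nu.2 ⟨hv, fun X hX => ?_⟩, fun X hX => ?_⟩
  · have hd : HasDerivAt (fun t : ℝ => inner ℝ (exp (t • X) v) y) (inner ℝ (X v) y) 0 := by
      simpa using (hasDerivAt_exp_smul_apply X v).inner ℝ (hasDerivAt_const (0 : ℝ) y)
    have hm : IsLocalMax (fun t : ℝ => inner ℝ (exp (t • X) v) y) 0 :=
      Eventually.of_forall fun t => by simpa using hmax _ (hX t)
    have := hm.hasDerivAt_eq_zero hd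
    rw [inner_lie hX] at this
    linarith
  -- The symmetric difference `E = exp (t • X) - exp (-t • X)` satisfies `⟪E v, E y⟫ = 2⟪v, y⟫ -
  -- ⟪exp (2t • X) v, y⟫ - ⟪exp (-2t • X) v, y⟫`, which is nonnegative by maximality. Division by
  -- `t²` gives `4⟪X v, X y⟫` in the limit.
  · have hE : HasDerivAt (fun t : ℝ => exp (t • X) - exp (t • (-X))) (X + X) 0 := by
      have := (hasDerivAt_exp_smul_zero X).fun_sub (hasDerivAt_exp_smul_zero (-X))
      simpa using this
    have hlim := hE.tendsto_slope_zero_right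
    simp only [zero_add, zero_smul, exp_zero, sub_self, sub_zero] at hlim
    have hcont : Continuous fun B : V →L[ℝ] V => inner ℝ (B v) (B y) := by fun_prop
    have h1 := (hcont.tendsto (X + X)).comp hlim
    have h2 : 0 ≤ inner ℝ ((X + X) v) ((X + X) y) := by
      refine ge_of_tendsto h1 (Eventually.of_forall fun t => ?_)
      simp only [Function.comp_apply, smul_apply, real_inner_smul_left,
        real_inner_smul_right]
      have hpt : exp (t • X) ∈ K := hX t
      have hE2 : ∀ r : ℝ, exp (r • (-X)) = star (exp (r • X)) := fun r => by
        rw [star_exp_of_mem (hX r), smul_neg]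
      have e2 : ∀ r : ℝ, exp (r • X) (exp (r • X) v) = exp ((r + r) • X) v := fun r => by
        rw [← mul_apply_eq_comp, add_smul, exp_add_of_commute_real (Commute.refl _)]
      have hneg : star (exp (t • X)) = exp ((-t) • X) := by
        rw [star_exp_of_mem hpt, neg_smul]
      have key : inner ℝ ((exp (t • X) - exp (t • (-X))) v) ((exp (t • X) - exp (t • (-X))) y)
          = 2 * inner ℝ v y - inner ℝ (exp ((t + t) • X) v) y
            - inner ℝ (exp ((-t + -t) • X) v) y := by
        rw [hE2, sub_apply, sub_apply, inner_sub_left,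
          inner_sub_right, inner_sub_right, inner_apply_apply hpt,
          inner_apply_apply (K.star_mem hpt), ← e2, ← e2, ← hneg]
        have a1 := inner_star_apply (star (exp (t • X))) (exp (t • X) v) y
        have a2 := inner_star_apply (exp (t • X)) (star (exp (t • X)) v) y
        rw [star_star] at a1
        linarith
      have k1 := hmax _ (hX (t + t))
      have k2 := hmax _ (hX (-t + -t))
      have : 0 ≤ inner ℝ ((exp (t • X) - exp (t • (-X))) v) ((exp (t • X) - exp (t • (-X))) y) := by
        rw [key]; linarith
      rcases le_total 0 t⁻¹ with ht | ht
      · positivity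
      · nlinarith [mul_nonneg (neg_nonneg.2 ht) (mul_nonneg (neg_nonneg.2 ht) this)]
    simp only [add_apply, inner_add_left, inner_add_right] at h2
    linarith

/-- Every orbit meets the chamber, in its points nearest to `y`. -/
theorem exists_apply_mem_chamber (hU : ∀ k ∈ K, ∀ u ∈ U, k u ∈ U) (hv : v ∈ U) (y : V) :
    ∃ k ∈ K, k v ∈ K.chamber U y ∧ ∀ g ∈ K, inner ℝ (g v) y ≤ inner ℝ (k v) y := by
  have hcont : Continuous fun g : V →L[ℝ] V => inner ℝ (g v) y := by fun_prop
  obtain ⟨k, hk, hmax⟩ := K.isCompact.exists_isMaxOn ⟨1, K.one_mem⟩ hcont.continuousOn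
  have hmax' : ∀ g ∈ K, inner ℝ (g v) y ≤ inner ℝ (k v) y := fun g hg => hmax hg
  refine ⟨k, hk, mem_chamber_of_isMax (hU k hk v hv) fun g hg => ?_, hmax'⟩
  simpa using hmax' (g * k) (K.mul_mem hg hk)

end OrthGroup

/-! ### Covering maps from quotients of compact spaces. -/

section QuotientCovering

variable {E B : Type*} [TopologicalSpace E] [TopologicalSpace B] [CompactSpace E] [T2Space E]
  {r : Setoid E}

/-- The saturation of a closed set is the projection of a compact subset of `E × E`. -/
theorem isClosedMap_quotient_mk (hclosed : IsClosed {p : E × E | r p.1 p.2}) :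
    IsClosedMap (Quotient.mk r) := by
  intro C hC
  rw [← isQuotientMap_quotient_mk'.isClosed_preimage]
  have : Quotient.mk r ⁻¹' (Quotient.mk r '' C)
      = Prod.snd '' ({p : E × E | r p.1 p.2} ∩ Prod.fst ⁻¹' C) := by
    ext e
    constructor
    · rintro ⟨c, hc, hce⟩
      exact ⟨(c, e), ⟨Quotient.exact hce, hc⟩, rfl⟩
    · rintro ⟨⟨c, e⟩, ⟨h, hc⟩, rfl⟩
      exact ⟨c, hc, Quotient.sound h⟩
  change IsClosed (Quotient.mk r ⁻¹' (Quotient.mk r '' C))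
  rw [this]
  exact ((hclosed.inter (hC.preimage continuous_fst)).isCompact.image continuous_snd).isClosed

/-- The set of classes contained in an open set is open. -/
theorem isOpen_compl_image_compl (hclosed : IsClosed {p : E × E | r p.1 p.2}) {W : Set E}
    (hW : IsOpen W) : IsOpen (Quotient.mk r '' Wᶜ)ᶜ :=
  (isClosedMap_quotient_mk hclosed _ hW.isClosed_compl).isOpen_compl

/-- Two classes are disjoint closed sets in a normal space; separating neighbourhoods can be shrunk
to saturated ones. -/
theorem t2Space_quotient (hclosed : IsClosed {p : E × E | r p.1 p.2}) : T2Space (Quotient r) := by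
  refine ⟨fun ξ η hne => ?_⟩
  have hsing : ∀ ξ : Quotient r, IsClosed (Quotient.mk r ⁻¹' {ξ}) := fun ξ => by
    obtain ⟨e, rfl⟩ := Quotient.exists_rep ξ
    refine IsClosed.preimage continuous_quotient_mk' ?_
    have := isClosedMap_quotient_mk hclosed {e} isClosed_singleton
    rwa [image_singleton] at this
  obtain ⟨U, W, hU, hW, hξ, hη, hd⟩ := normal_separation
    (hsing ξ) (hsing η) ((disjoint_singleton.2 hne).preimage _)
  refine ⟨_, _, isOpen_compl_image_compl hclosed hU, isOpen_compl_image_compl hclosed hW, ?_, ?_, ?_⟩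
  · rintro ⟨e, he, rfl⟩; exact he (hξ rfl)
  · rintro ⟨e, he, rfl⟩; exact he (hη rfl)
  · rw [Set.disjoint_left]
    intro ζ h1 h2
    obtain ⟨e, rfl⟩ := Quotient.exists_rep ζ
    have he1 : e ∈ U := by by_contra hc; exact h1 ⟨e, hc, rfl⟩
    have he2 : e ∈ W := by by_contra hc; exact h2 ⟨e, hc, rfl⟩
    exact hd.le_bot ⟨he1, he2⟩

/-- A quotient of a compact space `E` over `B` by an equivalence relation on the fibres which is
open and closed in the fibre product, and for which the classes can be lifted locally, is a covering
space of `B`. -/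
theorem isCoveringMap_quotient_lift [T2Space B] {f : E → B} (hf : Continuous f)
    (hr : ∀ e e', r e e' → f e = f e') (hclosed : IsClosed {p : E × E | r p.1 p.2})
    (hopen : IsClosed {p : E × E | f p.1 = f p.2 ∧ ¬ r p.1 p.2})
    (hlift : ∀ e, ∀ W : Set E, IsOpen W → (∀ e', r e e' → e' ∈ W) → f '' W ∈ 𝓝 (f e)) :
    IsCoveringMap (Quotient.lift f hr) := by
  have := t2Space_quotient hclosed
  have hcont : Continuous (Quotient.lift f hr) := hf.quotient_lift hr
  have hmap : IsOpenMap (Quotient.lift f hr) := by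
    intro O hO
    rw [isOpen_iff_mem_nhds]
    rintro _ ⟨ξ, hξ, rfl⟩
    obtain ⟨e, rfl⟩ := Quotient.exists_rep ξ
    refine mem_of_superset (hlift e (Quotient.mk r ⁻¹' O) (hO.preimage continuous_quotient_mk')
      fun e' he' => ?_) ?_
    · have : Quotient.mk r e' = Quotient.mk r e := (Quotient.sound he').symm
      rwa [mem_preimage, this]
    · rintro _ ⟨e', he', rfl⟩
      exact ⟨_, he', rfl⟩
  -- The quotient is compact Hausdorff, so a local homeomorphism suffices; openness is known and
  -- only local injectivity remains.
  rw [← isLocalHomeomorph_iff_isCoveringMap,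
    isLocalHomeomorph_iff_isOpenEmbedding_restrict]
  intro ξ
  -- The pairs of distinct classes in one fibre form a compact set that misses the diagonal, so a
  -- small neighbourhood of `ξ` contains no such pair.
  have hC : IsClosed (Prod.map (Quotient.mk r) (Quotient.mk r) ''
      {p : E × E | f p.1 = f p.2 ∧ ¬ r p.1 p.2}) :=
    (hopen.isCompact.image (continuous_quotient_mk'.prodMap continuous_quotient_mk')).isClosed
  have hξ : (ξ, ξ) ∉ Prod.map (Quotient.mk r) (Quotient.mk r) ''
      {p : E × E | f p.1 = f p.2 ∧ ¬ r p.1 p.2} := by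
    rintro ⟨⟨e, e'⟩, ⟨-, hne⟩, heq⟩
    have h1 := congrArg Prod.fst heq
    have h2 := congrArg Prod.snd heq
    exact hne (Quotient.exact (h1.trans h2.symm))
  have hnhds := hC.isOpen_compl.mem_nhds hξ
  rw [nhds_prod_eq, mem_prod_iff] at hnhds
  obtain ⟨O₁, hO₁, O₂, hO₂, hO⟩ := hnhds
  obtain ⟨O, hOsub, hOo, hξO⟩ := mem_nhds_iff.1 (inter_mem hO₁ hO₂)
  refine ⟨O, hOo.mem_nhds hξO, .of_continuous_injective_isOpenMap
    (hcont.comp continuous_subtype_val) ?_ (hmap.domRestrict hOo)⟩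
  rintro ⟨x, hx⟩ ⟨x', hx'⟩ hxx'
  obtain ⟨e, rfl⟩ := Quotient.exists_rep x
  obtain ⟨e', rfl⟩ := Quotient.exists_rep x'
  refine Subtype.ext (Quotient.sound ?_)
  by_contra hne
  exact hO ⟨(hOsub hx).1, (hOsub hx').2⟩ ⟨(e, e'), ⟨hxx', hne⟩, rfl⟩

end QuotientCovering

/-! ### The covering space attached to the chamber, and monodromy. -/

namespace OrthGroup

variable {K : OrthGroup V} {b g k w : V →L[ℝ] V} {U S : Submodule ℝ V} {c p s v y y' : V}

/-- The pointwise stabilizer of a subspace. -/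
def fix (K : OrthGroup V) (S : Submodule ℝ V) : OrthGroup V where
  carrier := {a | a ∈ K ∧ ∀ s ∈ S, a s = s}
  one_mem' := ⟨K.one_mem, by simp⟩
  mul_mem' := fun {a b} ha hb => ⟨K.mul_mem ha.1 hb.1, fun s hs => by simp [hb.2 s hs, ha.2 s hs]⟩
  star_mem' := fun {a} ha => ⟨K.star_mem ha.1, fun s hs => star_eq_of_apply_eq ha.1 (ha.2 s hs)⟩
  star_mul' := fun {a} ha => K.star_mul ha.1
  isCompact' := by
    have : {a : V →L[ℝ] V | a ∈ K ∧ ∀ s ∈ S, a s = s}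
        = (K : Set (V →L[ℝ] V)) ∩ ⋂ s ∈ S, {a | a s = s} := by
      ext a; simp
    rw [this]
    refine K.isCompact.inter_right (isClosed_biInter fun s _ => ?_)
    exact isClosed_eq (ContinuousLinearMap.apply ℝ V s).continuous continuous_const

theorem mem_fix : b ∈ K.fix S ↔ b ∈ K ∧ ∀ s ∈ S, b s = s := Iff.rfl

/-- Points of the chamber in the same orbit coincide. -/
def ChamberIsFundamental (K : OrthGroup V) (U : Submodule ℝ V) (y : V) : Prop :=
  ∀ s ∈ K.chamber U y, ∀ k ∈ K, k s ∈ K.chamber U y → k s = s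

namespace IsPolarAt

variable (h : IsPolarAt K U y)
include h

/-- The slice chamber is contained in the cone of directions that enter the chamber at `c`. This
converts statements about slices into statements about nearby chamber points. -/
theorem exists_pos_add_smul_mem_chamber (hc : c ∈ K.chamber U y)
    (hw : v ∈ (K.stab0 c).chamber (K.nu U c) y) :
    ∀ᶠ ε : ℝ in 𝓝[>] 0, c + ε • v ∈ K.chamber U y := by
  have hlim : Tendsto (fun ε : ℝ => c + ε • v) (𝓝[>] 0) (𝓝 c) := by
    have : Continuous fun ε : ℝ => c + ε • v := by fun_prop
    have h1 := this.tendsto 0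
    simp only [zero_smul, add_zero] at h1
    exact h1.mono_left nhdsWithin_le_nhds
  filter_upwards [hlim.eventually (h.eventually_mem_chamber hc), self_mem_nhdsWithin] with ε hε hpos
  exact hε (add_mem_chamber (h.chamber_subset_slice hc.1 hc) (smul_mem_chamber (le_of_lt hpos) hw))

/-- If the chamber is a fundamental domain, the isotropy group of one of its points is generated by
its identity component and the elements that fix the section pointwise. -/
theorem exists_eq_mul (hf : K.ChamberIsFundamental U y) (hc : c ∈ K.chamber U y) (hg : g ∈ K)
    (hgc : g c = c) : ∃ a ∈ K.stab0 c, ∃ b ∈ K.fix (K.nu U y), g = a * b := by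
  have hsl := h.slice hc.1
  have hgy : g y ∈ K.nu U c :=
    nu_invariant h.apply_mem hg hgc (h.mem_nu_of_mem hc.1 h.base_mem_nu)
  obtain ⟨a, ha, hay, -⟩ := exists_apply_mem_chamber hsl.apply_mem hgy y
  have haK := mem_of_mem_stab0 ha
  have hb : a * g ∈ K := K.mul_mem haK hg
  -- For small `ε` both `c + ε • y` and its image under `a * g` lie in the chamber, so the
  -- fundamental domain property makes them equal.
  have hby : (a * g) y = y := by
    obtain ⟨ε, ⟨h1, h2⟩, hε⟩ := (((h.exists_pos_add_smul_mem_chamber hc hay).and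
      (h.exists_pos_add_smul_mem_chamber hc hsl.base_mem_chamber)).and self_mem_nhdsWithin).exists
    have h3 : (a * g) (c + ε • y) = c + ε • a (g y) := by
      simp [hgc, apply_of_mem_stab0 ha]
    have h4 := hf _ h2 _ hb (by rw [h3]; exact h1)
    rw [h3] at h4
    exact smul_right_injective V (ne_of_gt hε) (add_left_cancel h4)
  refine ⟨star a, star_mem ha, a * g, ⟨hb, fun s hs => ?_⟩, ?_⟩
  · have hbs : (a * g) s ∈ K.nu U y := nu_invariant h.apply_mem hb hby hs
    -- The point `y` is interior to the chamber relative to the section, because the isotropy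
    -- algebra of `y` kills `y` and imposes no condition. The previous argument then applies in
    -- every direction `s`.
    have hpert : ∀ t ∈ K.nu U y, ∀ᶠ ε : ℝ in 𝓝[>] 0, y + ε • t ∈ K.chamber U y := fun t ht =>
      h.exists_pos_add_smul_mem_chamber h.base_mem_chamber
        ⟨by rw [h.nu_stab0 h.base_mem_nu]; exact ht, fun X hX => by
          rw [(mem_lie_stab0.1 hX).2, inner_zero_right]⟩
    obtain ⟨ε, ⟨h1, h2⟩, hε⟩ := (((hpert s hs).and (hpert _ hbs)).and self_mem_nhdsWithin).exists
    have h3 : (a * g) (y + ε • s) = y + ε • (a * g) s := by rw [map_add, map_smul, hby]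
    have h4 := hf _ h1 _ hb (by rw [h3]; exact h2)
    rw [h3] at h4
    exact smul_right_injective V (ne_of_gt hε) (add_left_cancel h4)
  · rw [← mul_assoc, K.star_mul haK, one_mul]

/-- Two ways to move a point near `p` into the chamber which are close to each other differ by
elements that fix the point and elements that fix the section. -/
theorem eventually_exists_eq_mul_mul (hk : k ∈ K) (hp : star k p ∈ K.chamber U y)
    (hf : (K.stab0 (star k p)).ChamberIsFundamental (K.nu U (star k p)) y)
    (hg : g ∈ K.stab0 p) :
    ∀ᶠ z : V × (V →L[ℝ] V) × (V →L[ℝ] V) in 𝓝 (p, k, g * k), z.2.1 ∈ K → z.2.2 ∈ K → star z.2.1 z.1 ∈ K.chamber U y →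
      star z.2.2 z.1 ∈ K.chamber U y →
      ∃ a ∈ K.stab0 z.1, ∃ b ∈ K.fix (K.nu U y), z.2.2 = a * z.2.1 * b := by
  have hgK := mem_of_mem_stab0 hg
  have hSL := K.eventually_mem_stab0 p
  have e1 : ∀ᶠ q in 𝓝 ((1 : V →L[ℝ] V), (p, k, g * k)),
      (k * star q.2.2.1 * star q.1, q.1 q.2.1) ∈ {z : (V →L[ℝ] V) × V | z.1 ∈ K →
        z.2 ∈ (K.tang p)ᗮ → z.1 z.2 ∈ (K.tang p)ᗮ → z.1 ∈ K.stab0 p} := by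
    have hc : Continuous fun q : (V →L[ℝ] V) × V × (V →L[ℝ] V) × (V →L[ℝ] V) =>
      (k * star q.2.2.1 * star q.1, q.1 q.2.1) := by fun_prop
    refine hc.continuousAt.eventually ?_
    simpa [K.mul_star hk] using hSL
  have e2 : ∀ᶠ q in 𝓝 ((1 : V →L[ℝ] V), (p, k, g * k)),
      (g * k * star q.2.2.2 * star q.1, q.1 q.2.1) ∈ {z : (V →L[ℝ] V) × V | z.1 ∈ K →
        z.2 ∈ (K.tang p)ᗮ → z.1 z.2 ∈ (K.tang p)ᗮ → z.1 ∈ K.stab0 p} := by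
    have hc : Continuous fun q : (V →L[ℝ] V) × V × (V →L[ℝ] V) × (V →L[ℝ] V) =>
      (g * k * star q.2.2.2 * star q.1, q.1 q.2.1) := by fun_prop
    refine hc.continuousAt.eventually ?_
    have : g * k * star (g * k) * star (1 : V →L[ℝ] V) = 1 := by
      rw [K.mul_star (K.mul_mem hgK hk), star_one, one_mul]
    simp only [this, one_apply_eq_self]
    exact hSL
  have e := e1.and e2
  rw [nhds_prod_eq] at e
  obtain ⟨W, hW, P, hP, hWP⟩ := eventually_prod_iff.1 e
  have hSE : ∀ᶠ z in 𝓝 (p, k, g * k), ∃ a ∈ K, a ∈ {a | W a} ∧ a z.1 ∈ (K.tang p)ᗮ :=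
    (continuous_fst (X := V) (Y := (V →L[ℝ] V) × (V →L[ℝ] V))).continuousAt
      (x := (p, k, g * k)) |>.eventually (K.eventually_exists_apply_mem_slice p hW)
  filter_upwards [hP, hSE]
  rintro ⟨v, k₁, k₂⟩ hz ⟨a, haK, haW, hav⟩ hk₁ hk₂ hc₁ hc₂
  dsimp only at *
  obtain ⟨h1, h2⟩ := hWP haW hz
  have hkp : k (star k p) = p := apply_star_apply hk p
  have hmove : ∀ s ∈ K.nu U y, k s ∈ (K.tang p)ᗮ := fun s hs => by
    have := apply_mem_tang_orthogonal hk (h.mem_nu_of_mem hp.1 hs).2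
    rwa [hkp] at this
  -- After `v` is moved to `a v` in the slice, this element is close to `1` and carries it to
  -- another point of the slice.
  have hg1 : k * star k₁ * star a ∈ K.stab0 p := by
    refine h1 (K.mul_mem (K.mul_mem hk (K.star_mem hk₁)) (K.star_mem haK)) hav ?_
    change (k * star k₁ * star a) (a v) ∈ _
    simp only [mul_apply_eq_comp, star_apply_apply haK]
    exact hmove _ hc₁.1
  have hg2 : g * k * star k₂ * star a ∈ K.stab0 p := by
    refine h2 (K.mul_mem (K.mul_mem (K.mul_mem hgK hk) (K.star_mem hk₂)) (K.star_mem haK)) hav ?_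
    change (g * k * star k₂ * star a) (a v) ∈ _
    simp only [mul_apply_eq_comp, star_apply_apply haK]
    have := apply_mem_tang_orthogonal hgK (hmove _ hc₂.1)
    rwa [apply_of_mem_stab0 hg] at this
  -- The element relating the chamber representatives `star k₁ v` and `star k₂ v` belongs to the
  -- slice group at `star k p`. Uniqueness in the slice equates them, and `exists_eq_mul` factors
  -- it.
  have hm : star k₂ * k₁ ∈ K.stab0 (star k p) := by
    have h3 := conj_mem_stab0 (K.star_mem hk) (mul_mem (mul_mem (star_mem hg) hg2) (star_mem hg1))
    convert h3 using 1
    simp only [StarMul.star_mul, star_star]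
    calc star k₂ * k₁ = (star k * (star g * g) * k) * star k₂ * (star a * a) * k₁ *
          (star k * k) := by
          rw [K.star_mul hgK, K.star_mul haK, mul_one (star k), K.star_mul hk]; simp
      _ = _ := by simp only [mul_assoc]
  have hmc : (star k₂ * k₁) (star k₁ v) = star k₂ v := by
    simp [apply_star_apply hk₁]
  have hsl := h.slice hp.1
  have hc₁' := h.chamber_subset_slice hp.1 hc₁
  have heq := hf _ hc₁' _ hm (by rw [hmc]; exact h.chamber_subset_slice hp.1 hc₂)
  obtain ⟨a₁, ha₁, b, hb, hab⟩ := hsl.exists_eq_mul hf hc₁' hm heq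
  have ha₁K : a₁ ∈ K.stab0 (star k₁ v) := stab0_mono (fun x hx => mem_of_mem_stab0 hx) ha₁
  have hbK : b ∈ K := mem_of_mem_stab0 (mem_fix.1 hb).1
  have hconj := star_mem (conj_mem_stab0 hk₂ ha₁K)
  have hk₂v : k₂ (star k₁ v) = v := by
    rw [← heq, hmc, apply_star_apply hk₂]
  rw [hk₂v] at hconj
  refine ⟨_, hconj, star b, star_mem ⟨hbK, fun s hs => (mem_fix.1 hb).2 s ?_⟩, ?_⟩
  · rw [h.nu_stab0 hp.1]; exact hs
  · have hk₁eq : k₁ = k₂ * (a₁ * b) := by rw [← hab, ← mul_assoc, K.mul_star hk₂, one_mul]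
    have ha₁' := mem_of_mem_stab0 ha₁K
    rw [hk₁eq]
    simp only [StarMul.star_mul, star_star]
    calc k₂ = k₂ * (star a₁ * (star k₂ * k₂) * a₁) * (b * star b) := by
          rw [K.star_mul hk₂, mul_one, K.star_mul ha₁', K.mul_star hbK, mul_one, mul_one]
      _ = _ := by simp only [mul_assoc]

/-- Points near `p` can be moved into the chamber by group elements near those that move `p`. -/
theorem eventually_exists_star_apply_mem_chamber (hk : k ∈ K)
    (hp : star k p ∈ K.chamber U y) {W : Set (V × (V →L[ℝ] V))} (hW : IsOpen W)
    (hpW : ∀ g ∈ K.stab0 p, (p, g * k) ∈ W) :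
    ∀ᶠ v in 𝓝 p, v ∈ U → ∃ k' ∈ K, (v, k') ∈ W ∧ star k' v ∈ K.chamber U y := by
  have hkp : k (star k p) = p := apply_star_apply hk p
  -- Compactness of `K.stab0 p` makes the choice of neighbourhood uniform in `g`; the element found
  -- below is only known to be near the whole coset `K.stab0 p * k`.
  have e1 : ∀ᶠ q in 𝓝 ((1 : V →L[ℝ] V), p), ∀ g ∈ (K.stab0 p : Set (V →L[ℝ] V)),
      (q.2, star q.1 * g * k) ∈ W := by
    refine (K.stab0 p).isCompact.eventually_forall_of_forall_eventually fun g hg => ?_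
    have hc : Continuous fun z : ((V →L[ℝ] V) × V) × (V →L[ℝ] V) =>
      (z.1.2, star z.1.1 * z.2 * k) := by fun_prop
    exact hc.continuousAt (hW.mem_nhds (by simpa using hpW g hg))
  obtain ⟨δ, hδ, hball⟩ := Metric.eventually_nhds_iff.1 (h.eventually_mem_chamber hp)
  have e2 : ∀ᶠ q in 𝓝 ((1 : V →L[ℝ] V), p), dist (q.1 q.2) p < δ := by
    have hc : Continuous fun q : (V →L[ℝ] V) × V => q.1 q.2 := by fun_prop
    exact hc.continuousAt (Metric.isOpen_ball.mem_nhds (by simpa using hδ))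
  have e := e1.and e2
  rw [nhds_prod_eq] at e
  obtain ⟨W', hW', P, hP, hWP⟩ := eventually_prod_iff.1 e
  filter_upwards [hP, K.eventually_exists_apply_mem_slice p hW']
  rintro v hv ⟨a, haK, haW, hav⟩ hvU
  obtain ⟨h1, h2⟩ := hWP haW hv
  have hw : star k (a v) ∈ K.nu U (star k p) :=
    ⟨h.apply_mem _ (K.star_mem hk) _ (h.apply_mem a haK v hvU),
      apply_mem_tang_orthogonal (K.star_mem hk) hav⟩
  have hsl := h.slice hp.1
  -- Move `v` into the slice, transport it by `star k`, and then into the slice chamber by `m`.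
  -- Since `m` fixes `star k p`, the result stays close to it and lies in the original chamber.
  obtain ⟨m, hm, hmc, -⟩ := exists_apply_mem_chamber hsl.apply_mem hw y
  have hmK := mem_of_mem_stab0 hm
  have hdist : dist (m (star k (a v))) (star k p) < δ := by
    rw [dist_eq_norm] at h2 ⊢
    have : m (star k (a v)) - star k p = m (star k (a v - p)) := by
      rw [map_sub, map_sub, apply_of_mem_stab0 hm]
    rwa [this, norm_apply hmK, norm_apply (K.star_mem hk)]
  refine ⟨star a * k * star m, K.mul_mem (K.mul_mem (K.star_mem haK) hk) (K.star_mem hmK), ?_, ?_⟩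
  · have hconj := conj_mem_stab0 hk (star_mem hm)
    rw [hkp] at hconj
    have := h1 _ hconj
    rw [mul_assoc (star a), mul_assoc (k * star m), K.star_mul hk, mul_one, ← mul_assoc] at this
    exact this
  · have : star (star a * k * star m) v = m (star k (a v)) := by
      simp [StarMul.star_mul, mul_assoc]
    rw [this]
    exact hball hdist hmc

end IsPolarAt

/-- The pairs of a point `b` of `B` and a group element that moves a point of the chamber to `b`. -/
def bundle (K : OrthGroup V) (U : Submodule ℝ V) (y : V) (B : Set V) : Set (V × (V →L[ℝ] V)) :=
  {e | e.1 ∈ B ∧ e.2 ∈ K ∧ star e.2 e.1 ∈ K.chamber U y}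

/-- Two elements of the bundle over the same point are equivalent if they differ by the identity
component of the isotropy group and by elements that fix the section. -/
def bundleSetoid (K : OrthGroup V) (U : Submodule ℝ V) (y : V) (B : Set V) :
    Setoid (K.bundle U y B) where
  r e e' := (e : V × (V →L[ℝ] V)).1 = (e' : V × (V →L[ℝ] V)).1 ∧
    ∃ a ∈ K.stab0 (e : V × (V →L[ℝ] V)).1, ∃ b ∈ K.fix (K.nu U y),
      (e' : V × (V →L[ℝ] V)).2 = a * (e : V × (V →L[ℝ] V)).2 * b
  iseqv :=
    { refl := fun e => ⟨rfl, 1, one_mem, 1, one_mem, by simp⟩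
      symm := by
        rintro ⟨⟨v, k⟩, he⟩ ⟨⟨v', k'⟩, he'⟩ ⟨h1, a, ha, b, hb, h2⟩
        dsimp only at *
        subst h1
        refine ⟨rfl, star a, star_mem ha, star b, star_mem hb, ?_⟩
        rw [h2]
        calc k = (star a * a) * k * (b * star b) := by
              rw [OrthGroup.star_mul ha, OrthGroup.mul_star hb, one_mul, mul_one]
          _ = _ := by simp only [mul_assoc]
      trans := by
        rintro ⟨⟨v, k⟩, he⟩ ⟨⟨v', k'⟩, he'⟩ ⟨⟨v'', k''⟩, he''⟩ ⟨h1, a, ha, b, hb, h2⟩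
          ⟨h3, a', ha', b', hb', h4⟩
        dsimp only at *
        subst h1 h3
        refine ⟨rfl, a' * a, mul_mem ha' ha, b * b', mul_mem hb hb', ?_⟩
        rw [h4, h2]
        simp only [mul_assoc] }

theorem isCompact_bundle {B : Set V} (hB : IsCompact B) : IsCompact (K.bundle U y B) := by
  have : K.bundle U y B = (B ×ˢ (K : Set (V →L[ℝ] V))) ∩ {e | star e.2 e.1 ∈ K.chamber U y} := by
    ext e; simp [bundle, and_assoc]
  rw [this]
  refine (hB.prod K.isCompact).inter_right (isClosed_chamber.preimage ?_)
  fun_prop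

/-- Upper semicontinuity of the isotropy components makes the graph of the relation together with
its witnesses `a` and `b` closed; the witnesses range over a compact set and can be projected away.
-/
theorem isClosed_bundleSetoid (K : OrthGroup V) (U : Submodule ℝ V) (y : V) (B : Set V) :
    IsClosed {q : K.bundle U y B × K.bundle U y B | K.bundleSetoid U y B q.1 q.2} := by
  have : CompactSpace (K : Set (V →L[ℝ] V)) := isCompact_iff_compactSpace.1 K.isCompact
  let T : Set ((K.bundle U y B × K.bundle U y B) × ↥(K : Set (V →L[ℝ] V)) × ↥(K : Set (V →L[ℝ] V))) :=
    {z | (z.1.1 : V × (V →L[ℝ] V)).1 = (z.1.2 : V × (V →L[ℝ] V)).1 ∧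
      (z.2.1 : V →L[ℝ] V) ∈ K.stab0 (z.1.1 : V × (V →L[ℝ] V)).1 ∧
      (z.2.2 : V →L[ℝ] V) ∈ K.fix (K.nu U y) ∧
      (z.1.2 : V × (V →L[ℝ] V)).2 = z.2.1 * (z.1.1 : V × (V →L[ℝ] V)).2 * z.2.2}
  have hT : IsClosed T := by
    refine (isClosed_eq (by fun_prop) (by fun_prop)).inter (.inter ?_ (.inter ?_
      (isClosed_eq (by fun_prop) (by fun_prop))))
    · exact K.isClosed_setOf_mem_stab0.preimage (f := fun z : (K.bundle U y B × K.bundle U y B) ×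
        ↥(K : Set (V →L[ℝ] V)) × ↥(K : Set (V →L[ℝ] V)) =>
          ((z.1.1 : V × (V →L[ℝ] V)).1, (z.2.1 : V →L[ℝ] V))) (by fun_prop)
    · exact (K.fix (K.nu U y)).isClosed.preimage (by fun_prop)
  have himg : {q : K.bundle U y B × K.bundle U y B | K.bundleSetoid U y B q.1 q.2}
      = Prod.fst '' T := by
    ext q
    constructor
    · rintro ⟨h1, a, ha, b, hb, h2⟩
      exact ⟨(q, ⟨a, mem_of_mem_stab0 ha⟩, ⟨b, (mem_fix.1 hb).1⟩), ⟨h1, ha, hb, h2⟩, rfl⟩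
    · rintro ⟨⟨q, a, b⟩, ⟨h1, ha, hb, h2⟩, rfl⟩
      exact ⟨h1, a, ha, b, hb, h2⟩
  rw [himg]
  exact isClosedMap_fst_of_compactSpace _ hT

/-- The projection of the bundle to its base. -/
def bundleProj (K : OrthGroup V) (U : Submodule ℝ V) (y : V) (B : Set V) (e : K.bundle U y B) : B :=
  ⟨(e : V × (V →L[ℝ] V)).1, e.2.1⟩

theorem continuous_bundleProj {B : Set V} : Continuous (K.bundleProj U y B) :=
  Continuous.subtype_mk (by fun_prop) _

theorem bundleProj_eq {B : Set V} (e e' : K.bundle U y B) (h : K.bundleSetoid U y B e e') :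
    K.bundleProj U y B e = K.bundleProj U y B e' := Subtype.ext h.1

/-- The inductive input: uniqueness in the slice chambers gives local injectivity, and existence in
them gives local lifts. Excluding the origin ensures that only slices at nonzero points are needed.
-/
theorem IsPolarAt.isCoveringMap (h : IsPolarAt K U y)
    (hf : ∀ p ∈ K.nu U y, p ≠ 0 → (K.stab0 p).ChamberIsFundamental (K.nu U p) y)
    {B : Set V} (hB : IsCompact B) (hBU : B ⊆ U) (hB0 : 0 ∉ B) :
    IsCoveringMap (Quotient.lift (K.bundleProj U y B) bundleProj_eq) := by
  have : CompactSpace (K.bundle U y B) := isCompact_iff_compactSpace.1 (isCompact_bundle hB)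
  have hne : ∀ e : K.bundle U y B,
      star (e : V × (V →L[ℝ] V)).2 (e : V × (V →L[ℝ] V)).1 ≠ 0 := by
    rintro ⟨⟨v, k⟩, hv, hk, hc⟩ h0
    rw [← norm_eq_zero, norm_apply (K.star_mem hk), norm_eq_zero] at h0
    exact hB0 (h0 ▸ hv)
  refine isCoveringMap_quotient_lift continuous_bundleProj bundleProj_eq
    (isClosed_bundleSetoid K U y B) ?_ ?_
  · rw [← isOpen_compl_iff, isOpen_iff_mem_nhds]
    rintro ⟨e₁, e₂⟩ he
    by_cases hr : K.bundleSetoid U y B e₁ e₂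
    · obtain ⟨h1, a, ha, b, hb, h2⟩ := hr
      -- The local statement treats representatives near `a * k`, so the factor `b` fixing the
      -- section is first removed from the second representative and restored afterwards.
      have hev := h.eventually_exists_eq_mul_mul e₁.2.2.1 e₁.2.2.2
        (hf _ e₁.2.2.2.1 (hne e₁)) ha
      have hc : Continuous fun q : K.bundle U y B × K.bundle U y B =>
        ((q.1 : V × (V →L[ℝ] V)).1, (q.1 : V × (V →L[ℝ] V)).2,
          (q.2 : V × (V →L[ℝ] V)).2 * star b) := by fun_prop
      have h3 : (e₂ : V × (V →L[ℝ] V)).2 * star b = a * (e₁ : V × (V →L[ℝ] V)).2 := by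
        rw [h2, mul_assoc, OrthGroup.mul_star hb, mul_one]
      have hev' : ∀ᶠ q in 𝓝 (e₁, e₂), _ := hc.continuousAt.eventually (by
        simp only [h3]; exact hev)
      filter_upwards [hev'] with q hq hq'
      refine hq'.2 ?_
      have hq1 : (q.1 : V × (V →L[ℝ] V)).1 = (q.2 : V × (V →L[ℝ] V)).1 :=
        congrArg Subtype.val hq'.1
      have hbK := (mem_fix.1 hb).1
      obtain ⟨a', ha', b', hb', h4⟩ := hq q.1.2.2.1 (K.mul_mem q.2.2.2.1 (K.star_mem hbK))
        q.1.2.2.2 (by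
          rw [StarMul.star_mul, star_star, mul_apply_eq_comp, hq1, (mem_fix.1 hb).2 _ q.2.2.2.2.1]
          exact q.2.2.2.2)
      refine ⟨hq1, a', ha', b' * b, mul_mem hb' hb, ?_⟩
      rw [← mul_assoc, ← h4, mul_assoc, OrthGroup.star_mul hb, mul_one]
    · have hne' : K.bundleProj U y B e₁ ≠ K.bundleProj U y B e₂ := fun h1 => he ⟨h1, hr⟩
      have hop : IsOpen {q : K.bundle U y B × K.bundle U y B |
          K.bundleProj U y B q.1 ≠ K.bundleProj U y B q.2} :=
        isOpen_ne_fun (continuous_bundleProj.comp continuous_fst)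
          (continuous_bundleProj.comp continuous_snd)
      filter_upwards [hop.mem_nhds hne'] with q hq hq'
      exact hq hq'.1
  · intro e W hW heW
    obtain ⟨W', hW', rfl⟩ := isOpen_induced_iff.1 hW
    have hp := h.eventually_exists_star_apply_mem_chamber e.2.2.1 e.2.2.2 hW' fun g hg => by
      have hgK := mem_of_mem_stab0 hg
      have hmem : ((e : V × (V →L[ℝ] V)).1, g * (e : V × (V →L[ℝ] V)).2) ∈ K.bundle U y B := by
        refine ⟨e.2.1, K.mul_mem hgK e.2.2.1, ?_⟩
        change star (g * (e : V × (V →L[ℝ] V)).2) (e : V × (V →L[ℝ] V)).1 ∈ _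
        rw [StarMul.star_mul, mul_apply_eq_comp, star_eq_of_apply_eq hgK (apply_of_mem_stab0 hg)]
        exact e.2.2.2
      exact heW ⟨_, hmem⟩ ⟨rfl, g, hg, 1, one_mem, by simp⟩
    have hcont : Tendsto (Subtype.val : B → V) (𝓝 (K.bundleProj U y B e))
        (𝓝 (e : V × (V →L[ℝ] V)).1) := continuous_subtype_val.tendsto (K.bundleProj U y B e)
    filter_upwards [hcont.eventually hp] with v hv
    obtain ⟨k', hk', hvW, hvc⟩ := hv (hBU v.2)
    exact ⟨⟨(v, k'), v.2, hk', hvc⟩, hvW, rfl⟩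

/-- If the cone from a point `y'` of the chamber over an orbit avoids the origin, this orbit meets
the chamber only once. -/
theorem IsPolarAt.apply_eq_of_cone (h : IsPolarAt K U y)
    (hf : ∀ p ∈ K.nu U y, p ≠ 0 → (K.stab0 p).ChamberIsFundamental (K.nu U p) y)
    (hy' : y' ∈ K.chamber U y) (hv : v ∈ K.chamber U y) (hw : w ∈ K) (hwv : w v ∈ K.chamber U y)
    (hcone : ∀ t : unitInterval, ∀ k ∈ K, (1 - (t : ℝ)) • y' + (t : ℝ) • k v ≠ 0) : w v = v := by
  have : CompactSpace (K : Set (V →L[ℝ] V)) := isCompact_iff_compactSpace.1 K.isCompact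
  have : PreconnectedSpace (K : Set (V →L[ℝ] V)) :=
    isPreconnected_iff_preconnectedSpace.1 h.isPreconnected
  let F : unitInterval × (K : Set (V →L[ℝ] V)) → V := fun z =>
    (1 - (z.1 : ℝ)) • y' + (z.1 : ℝ) • (z.2 : V →L[ℝ] V) v
  have hF : Continuous F := by fun_prop
  let B := range F
  have hBU : B ⊆ U := by
    rintro _ ⟨z, rfl⟩
    exact U.add_mem (U.smul_mem _ hy'.1.1) (U.smul_mem _ (h.apply_mem _ z.2.2 _ hv.1.1))
  have cov := h.isCoveringMap hf (isCompact_range hF) hBU (by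
    rintro ⟨z, hz⟩; exact hcone z.1 z.2 z.2.2 hz)
  let Q := Quotient (K.bundleSetoid U y B)
  let one : (K : Set (V →L[ℝ] V)) := ⟨1, K.one_mem⟩
  have hseg : ∀ x ∈ K.chamber U y, ∀ t : unitInterval,
      (1 - (t : ℝ)) • y' + (t : ℝ) • x ∈ K.chamber U y := fun x hx t =>
    add_mem_chamber (smul_mem_chamber (by linarith [t.2.2]) hy') (smul_mem_chamber t.2.1 hx)
  -- If `k v` is in the chamber, convexity keeps the segment from `y'` to `k v` there, so it lifts
  -- with group component `1`.
  let lift : ∀ k : (K : Set (V →L[ℝ] V)), (k : V →L[ℝ] V) v ∈ K.chamber U y → unitInterval → Q :=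
    fun k hk t => Quotient.mk _ ⟨(F (t, k), 1), ⟨(t, k), rfl⟩, K.one_mem, by
      rw [star_one, one_apply_eq_self]; exact hseg _ hk t⟩
  have hlift : ∀ k hk, Continuous (lift k hk) := fun k hk =>
    continuous_quotient_mk'.comp (Continuous.subtype_mk (by fun_prop) _)
  let H : C(unitInterval × (K : Set (V →L[ℝ] V)), B) :=
    ⟨fun z => ⟨F z, z, rfl⟩, Continuous.subtype_mk hF _⟩
  have hone : (one : V →L[ℝ] V) v ∈ K.chamber U y := by simpa [one] using hv
  let f₀ : C((K : Set (V →L[ℝ] V)), Q) := ContinuousMap.const _ (lift one hone 0)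
  have hH0 : ∀ k, H (0, k) = Quotient.lift (K.bundleProj U y B) bundleProj_eq (f₀ k) := fun k =>
    Subtype.ext (by simp [H, F, f₀, lift, bundleProj])
  -- Lift the cone over the orbit, starting at the constant class of `(y', 1)`.
  let L := cov.liftHomotopy H f₀ hH0
  have hL : ∀ t k, Quotient.lift (K.bundleProj U y B) bundleProj_eq (L (t, k)) = H (t, k) :=
    fun t k => congrFun (cov.liftHomotopy_lifts H f₀ hH0) (t, k)
  have hL0 : ∀ k, L (0, k) = lift one hone 0 := fun k => cov.liftHomotopy_zero H f₀ hH0 k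
  have hpath : ∀ k hk, L (1, k) = lift k hk 1 := fun k hk => by
    have := cov.eq_of_comp_eq (g₁ := fun t => L (t, k)) (g₂ := lift k hk) (by fun_prop) (hlift k hk)
      (funext fun t => by
        rw [Function.comp_apply, hL]; rfl) 0 (by
        rw [hL0]
        exact Quotient.sound ⟨by simp [F], 1, one_mem, 1, one_mem, by simp⟩)
    exact congrFun this 1
  have hmem : ∀ k : (K : Set (V →L[ℝ] V)), (F (1, k), (k : V →L[ℝ] V)) ∈ K.bundle U y B := fun k =>
    ⟨⟨(1, k), rfl⟩, k.2, by simpa [F, star_apply_apply (K := K) k.2] using hv⟩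
  -- At `t = 1` both sides lift `k ↦ k v` and agree at the identity, so they agree on the connected
  -- group `K`.
  have hend : (fun k => L (1, k)) = fun k => Quotient.mk (K.bundleSetoid U y B) ⟨_, hmem k⟩ := by
    refine cov.eq_of_comp_eq (by fun_prop)
      (continuous_quotient_mk'.comp (Continuous.subtype_mk (by fun_prop) _))
      (funext fun k => by rw [Function.comp_apply, hL]; rfl) one ?_
    rw [hpath one hone]
  -- Over `w` the two descriptions give that `(w v, 1)` and `(w v, w)` are equivalent: `w = a * b`,
  -- with `a` fixing `w v` and `b` fixing `v`.
  have hfin := (hpath ⟨w, hw⟩ hwv).symm.trans (congrFun hend ⟨w, hw⟩)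
  obtain ⟨-, a, ha, b, hb, hab⟩ := Quotient.exact hfin
  have hF1 : F (1, ⟨w, hw⟩) = w v := by simp [F]
  change a ∈ K.stab0 (F (1, ⟨w, hw⟩)) at ha
  rw [hF1] at ha
  have hab' : w = a * b := by simpa using hab
  have h1 : w v = a v := by
    conv_lhs => rw [hab']
    rw [mul_apply_eq_comp, (mem_fix.1 hb).2 v hv.1]
  have h2 : a (w v) = w v := apply_of_mem_stab0 ha
  have h3 : a (w v) = a v := h2.trans h1
  have := congrArg (fun x : V => (star a : V →L[ℝ] V) x) h3
  rwa [star_apply_apply ha, star_apply_apply ha] at this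

end OrthGroup

/-! ### Induction: the chamber is a fundamental domain. -/

namespace OrthGroup

variable {K : OrthGroup V} {k w : V →L[ℝ] V} {U : Submodule ℝ V} {p s v y z : V}

namespace IsPolarAt

/-- An orbit meets the section in finitely many points. -/
theorem finite_orbit_inter (h : IsPolarAt K U y) (v : V) :
    {s | s ∈ K.nu U y ∧ ∃ k ∈ K, k v = s}.Finite := by
  let C : Set (V →L[ℝ] V) := {g | g ∈ K ∧ g v ∈ K.nu U y}
  have hC : IsCompact C := K.isCompact.inter_right (t := {g | g v ∈ K.nu U y})
    ((Submodule.closed_of_finiteDimensional (K.nu U y)).preimage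
      (ContinuousLinearMap.apply ℝ V v).continuous)
  have himg : {s | s ∈ K.nu U y ∧ ∃ k ∈ K, k v = s} = (fun g : V →L[ℝ] V => g v) '' C := by
    ext s
    constructor
    · rintro ⟨hs, k, hk, rfl⟩; exact ⟨k, ⟨hk, hs⟩, rfl⟩
    · rintro ⟨k, ⟨hk, hs⟩, rfl⟩; exact ⟨hs, k, hk, rfl⟩
  rw [himg]
  refine hC.induction_on (p := fun t => ((fun g : V →L[ℝ] V => g v) '' t).Finite) (by simp)
    (fun s t hst ht => ht.subset (image_mono hst))
    (fun s t hs ht => by rw [image_union]; exact hs.union ht) fun g hg => ?_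
  refine ⟨{g' | g' ∈ C → g' v = g v} ∩ C, inter_mem (mem_nhdsWithin_of_mem_nhds ?_)
    self_mem_nhdsWithin, (finite_singleton (g v)).subset ?_⟩
  -- The orbit map is locally constant on `C`: for `g'` near `g`, the element `g' * star g` is near
  -- `1` and carries `g v` to a point of its own slice, so it fixes `g v`.
  · have hc : Continuous fun g' : V →L[ℝ] V => (g' * star g, g v) := by fun_prop
    have hev := hc.continuousAt (x := g) |>.eventually
      (show ∀ᶠ q in 𝓝 (g * star g, g v), q.1 ∈ K → q.2 ∈ (K.tang (g v))ᗮ →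
          q.1 q.2 ∈ (K.tang (g v))ᗮ → q.1 ∈ K.stab0 (g v) by
        rw [K.mul_star hg.1]; exact K.eventually_mem_stab0 (g v))
    filter_upwards [hev] with g' hg' hg'C
    have h1 : (g' * star g) (g v) = g' v := by simp [star_apply_apply hg.1]
    have h2 := hg' (K.mul_mem hg'C.1 (K.star_mem hg.1)) (mem_tang_orthogonal_self K _) (by
      rw [h1]; exact (h.mem_nu_of_mem hg.2 hg'C.2).2)
    rw [← h1, apply_of_mem_stab0 h2]
  · rintro _ ⟨g', ⟨h1, h2⟩, rfl⟩
    exact h1 h2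

/-- The orthogonal complement of a fixed vector in the section. -/
theorem inf_span_orthogonal (h : IsPolarAt K U y) (hp : ∀ X ∈ K.lie, X p = 0) (hpU : p ∈ U)
    (hp0 : p ≠ 0) :
    IsPolarAt K (U ⊓ (ℝ ∙ p)ᗮ) (y - (inner ℝ p y / inner ℝ p p) • p) where
  isPreconnected := h.isPreconnected
  apply_mem k hk u hu := by
    refine ⟨h.apply_mem k hk u hu.1, ?_⟩
    have h1 := Submodule.mem_orthogonal_singleton_iff_inner_right.1 hu.2
    refine Submodule.mem_orthogonal_singleton_iff_inner_right.2 ?_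
    rw [← apply_eq_of_lie_apply_eq_zero h.isPreconnected hp hk, inner_apply_apply hk, h1]
  base_mem := by
    refine ⟨U.sub_mem h.base_mem (U.smul_mem _ hpU),
      Submodule.mem_orthogonal_singleton_iff_inner_right.2 ?_⟩
    rw [inner_sub_right, real_inner_smul_right,
      div_mul_cancel₀ _ (inner_self_ne_zero.2 hp0), sub_self]
  inner_apply X hX s hs t ht := by
    have key : ∀ s ∈ K.nu (U ⊓ (ℝ ∙ p)ᗮ) (y - (inner ℝ p y / inner ℝ p p) • p), s ∈ K.nu U y :=
      fun s hs => mem_nu.2 ⟨hs.1.1, fun X hX => by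
        have := (mem_nu.1 hs).2 X hX
        rwa [map_sub, map_smul, hp X hX, smul_zero, sub_zero] at this⟩
    exact h.inner_apply X hX s (key s hs) t (key t ht)

/-- A fixed vector contributes the same component to `s` and to `k s`. Removing it leaves the action
of every `X` unchanged, so chamber points project to chamber points of the complement. -/
theorem apply_eq_of_fixed (h : IsPolarAt K U y) (hp : ∀ X ∈ K.lie, X p = 0) (hpU : p ∈ U)
    (hp0 : p ≠ 0) (hf : K.ChamberIsFundamental (U ⊓ (ℝ ∙ p)ᗮ)
      (y - (inner ℝ p y / inner ℝ p p) • p)) : K.ChamberIsFundamental U y := by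
  intro s hs k hk hks
  have hpp : inner ℝ p p ≠ 0 := inner_self_ne_zero.2 hp0
  have hkp := apply_eq_of_lie_apply_eq_zero h.isPreconnected hp hk
  have key : ∀ s ∈ K.chamber U y, s - (inner ℝ p s / inner ℝ p p) • p ∈
      K.chamber (U ⊓ (ℝ ∙ p)ᗮ) (y - (inner ℝ p y / inner ℝ p p) • p) := by
    intro s hs
    refine ⟨mem_nu.2 ⟨⟨U.sub_mem hs.1.1 (U.smul_mem _ hpU),
      Submodule.mem_orthogonal_singleton_iff_inner_right.2 ?_⟩, fun X hX => ?_⟩, fun X hX => ?_⟩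
    · rw [inner_sub_right, real_inner_smul_right, div_mul_cancel₀ _ hpp, sub_self]
    · rw [map_sub, map_smul, hp X hX, smul_zero, sub_zero, inner_sub_left, real_inner_smul_left,
        (mem_nu.1 hs.1).2 X hX]
      have := inner_lie hX p y
      rw [hp X hX, inner_zero_left] at this
      have h0 : inner ℝ p (X y) = 0 := by linarith
      rw [h0, mul_zero, sub_zero]
    · simp only [map_sub, map_smul, hp X hX, smul_zero, sub_zero]
      exact hs.2 X hX
  have hinner : inner ℝ p (k s) = inner ℝ p s := by
    conv_lhs => rw [← hkp]
    exact inner_apply_apply hk p s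
  have heq : k (s - (inner ℝ p s / inner ℝ p p) • p)
      = k s - (inner ℝ p (k s) / inner ℝ p p) • p := by
    rw [map_sub, map_smul, hkp, hinner]
  have := hf _ (key s hs) k hk (by rw [heq]; exact key _ hks)
  rw [heq, hinner] at this
  exact sub_left_injective this

/-- The case of a one-dimensional section. -/
theorem apply_eq_of_nu_le_span (h : IsPolarAt K U y) (hle : K.nu U y ≤ ℝ ∙ y)
    (hnf : y ≠ 0 → ∃ X ∈ K.lie, X y ≠ 0) : K.ChamberIsFundamental U y := by
  have key : ∀ s ∈ K.chamber U y, ∃ a : ℝ, 0 ≤ a ∧ s = a • y := by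
    intro s hs
    rcases eq_or_ne y 0 with rfl | hy
    · refine ⟨0, le_rfl, ?_⟩
      have := hle hs.1
      simpa using this
    obtain ⟨X, hX, hXy⟩ := hnf hy
    obtain ⟨a, rfl⟩ := Submodule.mem_span_singleton.1 (hle hs.1)
    refine ⟨a, ?_, rfl⟩
    have h1 := hs.2 X hX
    rw [map_smul, real_inner_smul_left] at h1
    have h2 : 0 < inner ℝ (X y) (X y) := real_inner_self_pos.2 hXy
    exact nonneg_of_mul_nonneg_left h1 h2
  intro s hs k hk hks
  obtain ⟨a, ha, hsa⟩ := key s hs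
  obtain ⟨c, hc, hsc⟩ := key _ hks
  have hn := norm_apply hk s
  rw [hsc, hsa, norm_smul, norm_smul, Real.norm_of_nonneg ha, Real.norm_of_nonneg hc] at hn
  rw [hsc, hsa]
  rcases eq_or_ne y 0 with rfl | hy
  · simp
  · rw [mul_right_cancel₀ (norm_ne_zero_iff.2 hy) hn]

/-- If the section has dimension at least two, there is a point of the chamber from which the cone
over a given orbit avoids the origin. -/
theorem exists_cone_ne_zero (h : IsPolarAt K U y) (hz : z ∈ K.nu U y) (hzy : z ∉ ℝ ∙ y)
    (hy0 : y ≠ 0) (hv0 : v ≠ 0) : ∃ y' ∈ K.chamber U y,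
      ∀ t : unitInterval, ∀ k ∈ K, (1 - (t : ℝ)) • y' + (t : ℝ) • k v ≠ 0 := by
  have hzD : ∀ᶠ ε : ℝ in 𝓝[>] 0, y + ε • z ∈ K.chamber U y :=
    h.exists_pos_add_smul_mem_chamber h.base_mem_chamber
      ⟨by rw [h.nu_stab0 h.base_mem_nu]; exact hz, fun X hX => by
        rw [(mem_lie_stab0.1 hX).2, inner_zero_right]⟩
  obtain ⟨δ, hδ, hsub⟩ := mem_nhdsGT_iff_exists_Ioo_subset.1 hzD
  have hlin : ∀ a b : ℝ, a • y + b • z = 0 → a = 0 ∧ b = 0 := by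
    intro a b hab
    have hb : b = 0 := by
      by_contra hb
      refine hzy (Submodule.mem_span_singleton.2 ⟨-(b⁻¹ * a), ?_⟩)
      have : b⁻¹ • (a • y + b • z) = 0 := by rw [hab, smul_zero]
      rw [smul_add, smul_smul, smul_smul, inv_mul_cancel₀ hb, one_smul] at this
      rw [neg_smul]
      exact (eq_neg_of_add_eq_zero_right this).symm
    rw [hb, zero_smul, add_zero] at hab
    exact ⟨(smul_eq_zero.1 hab).resolve_right hy0, hb⟩
  -- The rays through `y + ε • z` are pairwise distinct. If the orbit met the opposite of each, it
  -- would meet the section in infinitely many points.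
  have hex : ∃ ε ∈ Ioo 0 δ, ∀ t : ℝ, 0 ≤ t → ∀ k ∈ K, k v ≠ -(t • (y + ε • z)) := by
    by_contra hcon
    push Not at hcon
    choose! t ht k hk hkv using hcon
    have ht0 : ∀ ε ∈ Ioo 0 δ, t ε ≠ 0 := by
      intro ε hε h0
      have h1 := hkv ε hε
      rw [h0, zero_smul, neg_zero, ← norm_eq_zero, norm_apply (hk ε hε), norm_eq_zero] at h1
      exact hv0 h1
    refine (Set.infinite_of_injOn_mapsTo (s := Ioo 0 δ) (f := fun ε => k ε v) ?_ ?_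
      (Ioo_infinite hδ)) (h.finite_orbit_inter v)
    · intro ε hε ε' hε' heq
      simp only [hkv ε hε, hkv ε' hε', neg_inj] at heq
      have h1 := hlin (t ε - t ε') (t ε * ε - t ε' * ε') (by
        rw [sub_smul, sub_smul, mul_smul, mul_smul]
        rw [smul_add, smul_add] at heq
        rw [sub_add_sub_comm, heq, sub_self])
      have h2 : t ε' = t ε := by linarith [h1.1]
      have h3 : t ε * (ε - ε') = 0 := by have := h1.2; rw [h2] at this; linarith
      linarith [(mul_eq_zero.1 h3).resolve_left (ht0 ε hε)]
    · intro ε hε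
      refine ⟨?_, k ε, hk ε hε, rfl⟩
      simp only [hkv ε hε]
      exact neg_mem (Submodule.smul_mem _ _ (hsub hε).1)
  obtain ⟨ε, hε, hne⟩ := hex
  refine ⟨_, hsub hε, fun t k hk h0 => ?_⟩
  rcases eq_or_lt_of_le t.2.1 with ht | ht
  · rw [← ht, sub_zero, one_smul, zero_smul, add_zero] at h0
    have := hlin 1 ε (by rwa [one_smul])
    exact one_ne_zero this.1
  · refine hne ((t : ℝ)⁻¹ * (1 - t)) (mul_nonneg (inv_nonneg.2 ht.le) (by linarith [t.2.2])) k hk ?_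
    have : (t : ℝ)⁻¹ • ((1 - (t : ℝ)) • (y + ε • z) + (t : ℝ) • k v) = 0 := by rw [h0, smul_zero]
    rw [smul_add, smul_smul, smul_smul _ _ (k v), inv_mul_cancel₀ ht.ne', one_smul] at this
    exact eq_neg_of_add_eq_zero_right this

/-- The chamber is a fundamental domain for the action of a connected polar group. -/
theorem chamberIsFundamental (h : IsPolarAt K U y) : K.ChamberIsFundamental U y := by
  induction hn : Module.finrank ℝ U using Nat.strong_induction_on generalizing K U y with
  | _ n ih =>
    subst hn
    by_cases hfix : ∃ p ∈ K.nu U y, p ≠ 0 ∧ ∀ X ∈ K.lie, X p = 0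
    · obtain ⟨p, hp, hp0, hX⟩ := hfix
      refine h.apply_eq_of_fixed hX hp.1 hp0
        (ih _ (Submodule.finrank_lt_finrank_of_lt ?_) (h.inf_span_orthogonal hX hp.1 hp0) rfl)
      refine lt_of_le_of_ne inf_le_left fun heq => hp0 ?_
      have hmem : p ∈ U ⊓ (ℝ ∙ p)ᗮ := by rw [heq]; exact hp.1
      have := Submodule.mem_orthogonal_singleton_iff_inner_right.1 hmem.2
      exact inner_self_eq_zero.1 this
    · push Not at hfix
      -- Without fixed vectors some `X p` is nonzero; it lies in `U` but is tangent to the orbit, so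
      -- the slice space is strictly smaller.
      have hf : ∀ p ∈ K.nu U y, p ≠ 0 → (K.stab0 p).ChamberIsFundamental (K.nu U p) y := by
        intro p hp hp0
        obtain ⟨X, hX, hXp⟩ := hfix p hp hp0
        refine ih _ (Submodule.finrank_lt_finrank_of_lt ?_) (h.slice hp) rfl
        refine lt_of_le_of_ne inf_le_left fun heq => hXp ?_
        have hmem : X p ∈ K.nu U p := by
          rw [show K.nu U p = U from heq]; exact h.lie_apply_mem hX hp.1
        exact inner_self_eq_zero.1 ((mem_nu.1 hmem).2 X hX)
      by_cases hle : K.nu U y ≤ ℝ ∙ y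
      · exact h.apply_eq_of_nu_le_span hle (hfix y h.base_mem_nu)
      · obtain ⟨z, hz, hzy⟩ := SetLike.not_le_iff_exists.1 hle
        have hz0 : z ≠ 0 := fun h0 => hzy (h0 ▸ zero_mem _)
        obtain ⟨X, hX, hXz⟩ := hfix z hz hz0
        have hy0 : y ≠ 0 := fun h0 => hXz (h.apply_eq_zero hX (by rw [h0, map_zero]) hz)
        intro v hv w hw hwv
        rcases eq_or_ne v 0 with rfl | hv0
        · exact map_zero w
        obtain ⟨y', hy', hcone⟩ := h.exists_cone_ne_zero hz hzy hy0 hv0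
        exact h.apply_eq_of_cone hf hy' hv hw hwv hcone

end IsPolarAt

end OrthGroup

/-! ### Existence of a regular point in a section. -/

namespace OrthGroup

variable {K : OrthGroup V} {S : Submodule ℝ V} {s v y : V}

theorem contDiff_exp_real {A : Type*} [NormedRing A] [NormedAlgebra ℝ A] [CompleteSpace A]
    {n : WithTop ℕ∞} : ContDiff ℝ n (exp : A → A) :=
  AnalyticOnNhd.contDiff fun x _ => NormedSpace.exp_analytic (𝕂 := ℝ) x

theorem contDiff_exp_smul_apply (X : V →L[ℝ] V) (v : V) {n : WithTop ℕ∞} :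
    ContDiff ℝ n fun t : ℝ => exp (t • X) v :=
  (contDiff_exp_real.comp (contDiff_id.smul contDiff_const)).clm_apply contDiff_const

/-- A subfamily of a basis of the Lie algebra that is complementary to the isotropy algebra. -/
theorem exists_finset_sup_eq_lie {d : ℕ} (b : Module.Basis (Fin d) ℝ K.lie) (s : V) :
    ∃ I : Finset (Fin d), I.card ≤ Module.finrank ℝ (K.tang s) ∧
      (K.stab0 s).lie ⊔ Submodule.span ℝ (range fun i : I => (b i : V →L[ℝ] V)) = K.lie := by
  classical
  obtain ⟨κ, a, ha, hspan, hli⟩ :=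
    exists_linearIndependent' ℝ fun i : Fin d => (b i : V →L[ℝ] V) s
  have : Fintype κ := Fintype.ofInjective a ha
  have hle : Submodule.span ℝ (range fun i : Fin d => (b i : V →L[ℝ] V) s) = K.tang s := by
    apply le_antisymm
    · rw [Submodule.span_le]
      rintro _ ⟨i, rfl⟩
      exact apply_mem_tang (b i).2
    · intro v hv
      obtain ⟨X, hX, rfl⟩ := mem_tang.1 hv
      have h1 := b.sum_repr ⟨X, hX⟩
      have h2 : X = ∑ i, b.repr ⟨X, hX⟩ i • (b i : V →L[ℝ] V) := by
        have h3 := (congrArg K.lie.subtype h1).symm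
        rwa [map_sum] at h3
      rw [h2, sum_apply]
      exact Submodule.sum_mem _ fun i _ => Submodule.smul_mem _ _ (Submodule.subset_span ⟨i, rfl⟩)
  refine ⟨Finset.univ.image a, ?_, ?_⟩
  · rw [Finset.card_image_of_injective _ ha, Finset.card_univ, ← hle, ← hspan,
      finrank_span_eq_card hli]
  · apply le_antisymm
    · refine sup_le (fun X hX => (mem_lie_stab0.1 hX).1) ?_
      rw [Submodule.span_le]
      rintro _ ⟨i, rfl⟩
      exact (b i).2
    · intro X hX
      have h1 : X s ∈ Submodule.span ℝ (range ((fun i : Fin d => (b i : V →L[ℝ] V) s) ∘ a)) := by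
        rw [hspan, hle]; exact apply_mem_tang hX
      obtain ⟨c, hc⟩ := (Submodule.mem_span_range_iff_exists_fun ℝ).1 h1
      rw [Submodule.mem_sup]
      have hZ : ∑ j, c j • (b (a j) : V →L[ℝ] V) ∈ Submodule.span ℝ
          (range fun i : (Finset.univ.image a : Finset (Fin d)) => (b i : V →L[ℝ] V)) :=
        Submodule.sum_mem _ fun j _ => Submodule.smul_mem _ _ (Submodule.subset_span
          ⟨⟨a j, Finset.mem_image_of_mem a (Finset.mem_univ j)⟩, rfl⟩)
      have hZK : ∑ j, c j • (b (a j) : V →L[ℝ] V) ∈ K.lie :=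
        Submodule.sum_mem _ fun j _ => Submodule.smul_mem _ _ (b (a j)).2
      refine ⟨X - ∑ j, c j • (b (a j) : V →L[ℝ] V), mem_lie_stab0.2 ⟨sub_mem hX hZK, ?_⟩, _, hZ,
        sub_add_cancel _ _⟩
      rw [sub_apply, sum_apply, ← hc, sub_eq_zero]
      rfl

/-- A section that meets every orbit contains a point whose normal space is the section. -/
theorem exists_tang_orthogonal_le (hmeet : ∀ v, ∃ k ∈ K, k v ∈ S)
    (hort : ∀ X ∈ K.lie, ∀ s ∈ S, ∀ t ∈ S, inner ℝ (X s) t = 0) :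
    ∃ y ∈ S, (K.tang y)ᗮ ≤ S := by
  by_contra! hcon
  have hlt : ∀ y ∈ S, Module.finrank ℝ (K.tang y) + Module.finrank ℝ S < Module.finrank ℝ V := by
    intro y hy
    have hle : S ≤ (K.tang y)ᗮ := fun s hs => mem_tang_orthogonal.2 fun X hX => by
      rw [real_inner_comm]; exact hort X hX y hy s hs
    have h1 := Submodule.finrank_lt_finrank_of_lt (lt_of_le_not_ge hle (hcon y hy))
    have h2 := (K.tang y).finrank_add_finrank_orthogonal
    omega
  let b := Module.finBasis ℝ K.lie
  set d := Module.finrank ℝ K.lie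
  obtain ⟨D, hDc, hDd⟩ := TopologicalSpace.exists_countable_dense ↥(K : Set (V →L[ℝ] V))
  have : Countable D := hDc.to_subtype
  -- Every `v` is reached from some `s` in `S` by one of countably many group elements and an
  -- exponential in at most `dim (K.tang s)` basis directions; the isotropy factor is absorbed by
  -- `s`.
  let ι := {x : D × Finset (Fin d) // x.2.card + Module.finrank ℝ S < Module.finrank ℝ V}
  let F : ∀ x : ι, (x.1.2 → ℝ) × S → V := fun x z =>
    (x.1.1 : V →L[ℝ] V) (exp (∑ i, z.1 i • (b i : V →L[ℝ] V)) z.2)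
  have hF : ∀ x, ContDiff ℝ 1 (F x) := fun x => by
    refine (ContinuousLinearMap.contDiff _).comp
      (ContDiff.clm_apply (contDiff_exp_real.comp ?_) (S.subtypeL.contDiff.comp contDiff_snd))
    refine ContDiff.sum fun i _ => ContDiff.fun_smul ?_ contDiff_const
    exact (contDiff_apply ℝ ℝ i).comp contDiff_fst
  have hcover : (univ : Set V) ⊆ ⋃ x, range (F x) := by
    intro v _
    obtain ⟨k, hk, hks⟩ := hmeet v
    set s := k v with hs
    obtain ⟨I, hI, hsup⟩ := exists_finset_sup_eq_lie b s
    have hev := eventually_exists_exp_mul_exp hsup univ_mem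
    have hcont : Continuous fun j : ↥(K : Set (V →L[ℝ] V)) => star (j : V →L[ℝ] V) * star k := by
      fun_prop
    have ht : Tendsto (fun j : ↥(K : Set (V →L[ℝ] V)) => star (j : V →L[ℝ] V) * star k)
        (𝓝 ⟨star k, K.star_mem hk⟩) (𝓝 1) := by
      have := hcont.tendsto ⟨star k, K.star_mem hk⟩
      simpa [K.mul_star hk] using this
    obtain ⟨j, hjD, hj⟩ := hDd.inter_nhds_nonempty (ht hev)
    obtain ⟨Z, hZ, -, Y, hY, -, hg⟩ := hj (K.mul_mem (K.star_mem j.2) (K.star_mem hk))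
    obtain ⟨c, rfl⟩ := (Submodule.mem_span_range_iff_exists_fun ℝ).1 hZ
    refine mem_iUnion.2 ⟨⟨(⟨j, hjD⟩, I), ?_⟩, (c, ⟨s, hks⟩), ?_⟩
    · exact (Nat.add_le_add_right hI _).trans_lt (hlt s hks)
    · have hYs : exp Y s = s := by
        simpa using exp_smul_apply_of_apply_eq_zero (mem_lie_stab0.1 hY).2 1
      change (j : V →L[ℝ] V) (exp (∑ i, c i • (b i : V →L[ℝ] V)) s) = v
      have h1 : star (j : V →L[ℝ] V) (star k s) = exp (∑ i, c i • (b i : V →L[ℝ] V)) (exp Y s) :=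
        DFunLike.congr_fun hg s
      rw [hYs] at h1
      rw [← h1, apply_star_apply j.2, hs, star_apply_apply hk]
  -- The countably many `C¹` maps have sources of dimension less than `dim V`, so their images
  -- cannot cover `V` by Hausdorff dimension.
  have hdim : (Module.finrank ℝ V : ℝ≥0∞) ≤ ((Module.finrank ℝ V - 1 : ℕ) : ℝ≥0∞) := by
    rw [← Real.dimH_univ_eq_finrank V]
    refine (dimH_mono hcover).trans ?_
    rw [dimH_iUnion]
    refine iSup_le fun x => (hF x).dimH_range_le.trans ?_
    have := x.2
    rw [Module.finrank_prod, Module.finrank_fintype_fun_eq_card, Fintype.card_coe]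
    exact_mod_cast (by omega)
  have h0 := hlt 0 S.zero_mem
  have : Module.finrank ℝ V ≤ Module.finrank ℝ V - 1 := by exact_mod_cast hdim
  omega

/-- A group with a section is polar at some point of the section. -/
theorem exists_isPolarAt (hK : IsPreconnected (K : Set (V →L[ℝ] V)))
    (hmeet : ∀ v, ∃ k ∈ K, k v ∈ S)
    (hort : ∀ X ∈ K.lie, ∀ s ∈ S, ∀ t ∈ S, inner ℝ (X s) t = 0) :
    ∃ y, IsPolarAt K ⊤ y := by
  obtain ⟨y, hy, hyS⟩ := exists_tang_orthogonal_le hmeet hort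
  exact ⟨y, hK, fun _ _ _ _ => trivial, trivial,
    fun X hX s hs t ht => hort X hX s (hyS hs.2) t (hyS ht.2)⟩

end OrthGroup

/-! ### From the representation to a group of operators. -/

namespace OrthogonalRepresentation

open OrthGroup

variable {G : Type*} [Group G] [TopologicalSpace G] (ρ : OrthogonalRepresentation G V)

/-- The image of a compact group under an orthogonal representation. -/
noncomputable def image [CompactSpace G] : OrthGroup V where
  carrier := range fun g => (ρ.toHom g).toContinuousLinearEquiv.toContinuousLinearMap
  one_mem' := ⟨1, by ext; simp⟩
  mul_mem' := by
    rintro _ _ ⟨g, rfl⟩ ⟨h, rfl⟩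
    exact ⟨g * h, by ext; simp⟩
  star_mem' := by
    rintro _ ⟨g, rfl⟩
    refine ⟨g⁻¹, ContinuousLinearMap.ext fun v => ext_inner_right ℝ fun w => ?_⟩
    rw [ContinuousLinearMap.star_eq_adjoint, ContinuousLinearMap.adjoint_inner_left]
    have := (ρ.toHom g).inner_map_map (ρ.toHom g⁻¹ v) w
    rw [map_inv] at this
    change inner ℝ (ρ.toHom g⁻¹ v) w = inner ℝ v (ρ.toHom g w)
    rw [map_inv, ← this]
    congr 1
    exact (ρ.toHom g).apply_symm_apply v
  star_mul' := by
    rintro _ ⟨g, rfl⟩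
    refine ContinuousLinearMap.ext fun v => ext_inner_right ℝ fun w => ?_
    rw [ContinuousLinearMap.star_eq_adjoint, mul_apply_eq_comp,
      ContinuousLinearMap.adjoint_inner_left]
    exact (ρ.toHom g).inner_map_map v w
  isCompact' := isCompact_range (continuous_clm_apply.2 fun v => ρ.continuous_apply v)

variable [CompactSpace G]

theorem exists_apply_of_mem_image {k : V →L[ℝ] V} (hk : k ∈ ρ.image) :
    ∃ g : G, ∀ v, k v = ρ.toHom g v := by
  obtain ⟨g, rfl⟩ := hk
  exact ⟨g, fun _ => rfl⟩

theorem exists_mem_image (g : G) : ∃ k ∈ ρ.image, ∀ v, k v = ρ.toHom g v :=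
  ⟨_, ⟨g, rfl⟩, fun _ => rfl⟩

theorem isPreconnected_image [ConnectedSpace G] :
    IsPreconnected (ρ.image : Set (V →L[ℝ] V)) :=
  isPreconnected_range (continuous_clm_apply.2 fun v => ρ.continuous_apply v)

theorem exists_isPolarAt_image [ConnectedSpace G] (hρ : ρ.IsPolar) :
    ∃ y, IsPolarAt ρ.image ⊤ y := by
  obtain ⟨S, hmeet, hort⟩ := hρ
  refine exists_isPolarAt (S := S) ρ.isPreconnected_image (fun v => ?_) fun X hX s hs t ht => ?_
  · obtain ⟨_, ⟨g, rfl⟩, hg⟩ := hmeet v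
    obtain ⟨k, hk, hkg⟩ := ρ.exists_mem_image g
    exact ⟨k, hk, by rw [hkg]; exact hg⟩
  -- The smooth curve `r ↦ exp (r • X) s` stays in the orbit of `s`, so `X s` is one of the tangent
  -- vectors to which the section is orthogonal.
  · refine hort s hs _ ⟨fun r : ℝ => exp (r • X) s, contDiff_exp_smul_apply X s, fun r => ?_,
      by simp, (hasDerivAt_exp_smul_apply X s).deriv⟩ t ht
    obtain ⟨g, hg⟩ := ρ.exists_apply_of_mem_image (mem_lie.1 hX r)
    exact ⟨g, (hg s).symm⟩

end OrthogonalRepresentation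

/-! ### Chamber points realize the distance of their orbits. -/

theorem LinearMap.IsSymmetric.inner_nonneg_of_inner_mul_nonneg {T : Type*}
    [NormedAddCommGroup T] [InnerProductSpace ℝ T] [FiniteDimensional ℝ T] {A B : T →ₗ[ℝ] T}
    (hB : B.IsSymmetric) (hA : ∀ u ≠ 0, 0 < inner ℝ (A u) u)
    (hBA : ∀ u, 0 ≤ inner ℝ (B u) (A u)) (u : T) : 0 ≤ inner ℝ (B u) u := by
  let e := hB.eigenvectorBasis rfl
  have he : ∀ i, B (e i) = hB.eigenvalues rfl i • e i := fun i => hB.apply_eigenvectorBasis rfl i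
  -- On an eigenvector `e` of `B` with eigenvalue `c`, the hypothesis reads `0 ≤ c * ⟪A e, e⟫`,
  -- whose second factor is positive.
  have hpos : ∀ i, 0 ≤ hB.eigenvalues rfl i := fun i => by
    have h1 := hBA (e i)
    rw [he, real_inner_smul_left, real_inner_comm] at h1
    exact nonneg_of_mul_nonneg_left h1 (hA _ (e.orthonormal.ne_zero i))
  rw [← e.sum_inner_mul_inner]
  refine Finset.sum_nonneg fun i _ => ?_
  rw [hB, he, real_inner_smul_right, real_inner_comm u (e i), mul_assoc]
  exact mul_nonneg (hpos i) (mul_self_nonneg _)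

namespace OrthGroup

variable {K : OrthGroup V} {g : V →L[ℝ] V} {x y z : V}

namespace IsPolarAt

variable (h : IsPolarAt K ⊤ y)
include h

/-- The linear operator on the tangent space at `y` that sends the velocity `X y` to `X s`, for `s`
in the section. -/
theorem exists_velocity_operator (hs : x ∈ K.nu ⊤ y) : ∃ A : K.tang y →ₗ[ℝ] K.tang y,
    A.IsSymmetric ∧ ∀ X (hX : X ∈ K.lie), (A ⟨X y, apply_mem_tang hX⟩ : V) = X x := by
  obtain ⟨R, hR, hRy⟩ := exists_lift K y
  have hmem : ∀ X ∈ K.lie, X x ∈ K.tang y := fun X hX => by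
    rw [← Submodule.orthogonal_orthogonal (K.tang y), Submodule.mem_orthogonal]
    intro t ht
    rw [real_inner_comm]
    exact h.inner_apply X hX x hs t ⟨trivial, ht⟩
  let A : K.tang y →ₗ[ℝ] K.tang y :=
    { toFun := fun w => ⟨R w x, hmem _ (hR w)⟩
      map_add' := fun v w => by ext; simp
      map_smul' := fun c w => by ext; simp }
  have hA : ∀ X (hX : X ∈ K.lie), (A ⟨X y, apply_mem_tang hX⟩ : V) = X x := fun X hX =>
    h.lift_apply hR hRy hX hs
  refine ⟨A, ?_, hA⟩
  rintro ⟨v, hv⟩ ⟨w, hw⟩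
  obtain ⟨X, hX, rfl⟩ := mem_tang.1 hv
  obtain ⟨Z, hZ, rfl⟩ := mem_tang.1 hw
  rw [Submodule.coe_inner, Submodule.coe_inner, hA X hX, hA Z hZ,
    h.inner_lie_comm hX hZ hs h.base_mem_nu, real_inner_comm]

/-- The positivity makes `z` regular with the same section as `y`. A maximizer of `⟪·, z⟫` on the
orbit of `x` then lies in the chamber of `y` and must be `x`. -/
theorem inner_apply_le_of_pos (hz : z ∈ K.chamber ⊤ y)
    (hpos : ∀ X ∈ K.lie, X y ≠ 0 → 0 < inner ℝ (X z) (X y)) (hx : x ∈ K.chamber ⊤ y)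
    (hg : g ∈ K) : inner ℝ (g x) z ≤ inner ℝ x z := by
  obtain ⟨k, hk, hkx, hmax⟩ :=
    exists_apply_mem_chamber h.apply_mem (Submodule.mem_top : x ∈ ⊤) z
  have hnu : k x ∈ K.nu ⊤ y := by
    obtain ⟨X, hX, s, hs, hu⟩ := h.exists_add (Submodule.mem_top : k x ∈ ⊤)
    have h0 : X y = 0 := by
      by_contra hne
      have h1 := (mem_nu.1 hkx.1).2 X hX
      rw [hu, inner_add_left, (mem_nu.1 (h.mem_nu_of_mem hz.1 hs)).2 X hX, add_zero,
        real_inner_comm] at h1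
      exact (hpos X hX hne).ne' h1
    rw [hu, h0, zero_add]
    exact hs
  -- With `A : X y ↦ X z` positive definite and `B : X y ↦ X (k x)` symmetric, the chamber condition
  -- relative to `z` is `⟪B u, A u⟫ ≥ 0`, the one relative to `y` is `⟪B u, u⟫ ≥ 0`.
  obtain ⟨A, -, hA⟩ := h.exists_velocity_operator hz.1
  obtain ⟨B, hBs, hB⟩ := h.exists_velocity_operator hnu
  have hB0 := hBs.inner_nonneg_of_inner_mul_nonneg (A := A)
    (by
      rintro ⟨w, hw⟩ hne
      obtain ⟨X, hX, rfl⟩ := mem_tang.1 hw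
      rw [Submodule.coe_inner, hA X hX]
      exact hpos X hX fun h0 => hne (Subtype.ext h0))
    (by
      rintro ⟨w, hw⟩
      obtain ⟨X, hX, rfl⟩ := mem_tang.1 hw
      rw [Submodule.coe_inner, hA X hX, hB X hX]
      exact hkx.2 X hX)
  have hkxD : k x ∈ K.chamber ⊤ y := ⟨hnu, fun X hX => by
    have := hB0 ⟨X y, apply_mem_tang hX⟩
    rwa [Submodule.coe_inner, hB X hX] at this⟩
  have := hmax g hg
  rwa [h.chamberIsFundamental x hx k hk hkxD] at this

/-- Among the points of an orbit, the one in the chamber is nearest to each point of the chamber. -/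
theorem inner_apply_le (hz : z ∈ K.chamber ⊤ y) (hx : x ∈ K.chamber ⊤ y) (hg : g ∈ K) :
    inner ℝ (g x) z ≤ inner ℝ x z := by
  -- Adding `ε • y` makes the chamber inequalities of `z` strict wherever `X y ≠ 0`.
  have key : ∀ ε ∈ Ioi (0 : ℝ), inner ℝ (g x) (z + ε • y) ≤ inner ℝ x (z + ε • y) := by
    intro ε hε
    refine h.inner_apply_le_of_pos (add_mem_chamber hz
      (smul_mem_chamber (le_of_lt hε) h.base_mem_chamber)) (fun X hX hne => ?_) hx hg
    rw [map_add, map_smul, inner_add_left, real_inner_smul_left]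
    exact add_pos_of_nonneg_of_pos (hz.2 X hX) (mul_pos hε (real_inner_self_pos.2 hne))
  have hcont : ∀ v : V, Tendsto (fun ε : ℝ => inner ℝ v (z + ε • y)) (𝓝[>] 0) (𝓝 (inner ℝ v z)) :=
    fun v => by
      have : Continuous fun ε : ℝ => inner ℝ v (z + ε • y) := by fun_prop
      simpa using (this.tendsto 0).mono_left nhdsWithin_le_nhds
  exact le_of_tendsto_of_tendsto (hcont _) (hcont _) (eventually_nhdsWithin_of_forall key)

theorem dist_le_dist_apply (hz : z ∈ K.chamber ⊤ y) (hx : x ∈ K.chamber ⊤ y) (hg : g ∈ K) :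
    dist z x ≤ dist z (g x) := by
  rw [dist_eq_norm, dist_eq_norm]
  refine le_of_sq_le_sq ?_ (norm_nonneg _)
  rw [norm_sub_sq_real, norm_sub_sq_real, norm_apply hg, real_inner_comm, real_inner_comm (g x)]
  linarith [h.inner_apply_le hz hx hg]

end IsPolarAt

end OrthGroup

/-! ### Minimal geodesics in an isometric image of a convex set. -/

section Geodesics

variable {M : Type*} [PseudoEMetricSpace M] {D : Set V} {f : V → M} {p q : M}

theorem edist_add_edist_add_edist_le_curveLength (δ : Path p q) {s t : unitInterval} (hst : s ≤ t) :
    edist p (δ s) + edist (δ s) (δ t) + edist (δ t) q ≤ curveLength δ := by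
  let u : ℕ → unitInterval := fun n =>
    match n with
    | 0 => 0
    | 1 => s
    | 2 => t
    | _ => 1
  have hu : Monotone u := monotone_nat_of_le_succ fun n => by
    match n with
    | 0 => exact unitInterval.nonneg'
    | 1 => exact hst
    | 2 => exact unitInterval.le_one'
    | _ + 3 => exact le_rfl
  have := eVariationOn.sum_le (f := δ) (n := 3) hu fun i => mem_univ (u i)
  simp only [Finset.sum_range_succ, Finset.sum_range_zero, zero_add] at this
  simp only [u, Path.source, Path.target] at this
  rwa [edist_comm p, edist_comm (δ s) (δ t), edist_comm (δ t) q]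

/-- If a space is covered isometrically by a convex set, its points are joined by a minimal
geodesic segment, unique up to reparametrization. -/
theorem exists_unique_minimalGeodesicSegment (hD : Convex ℝ D)
    (hf : ∀ a ∈ D, ∀ b ∈ D, edist (f a) (f b) = edist a b) (hsurj : ∀ m, ∃ a ∈ D, f a = m)
    (p q : M) : ∃ γ : Path p q, IsMinimalGeodesicSegment γ ∧
      ∀ δ : Path p q, IsMinimalGeodesicSegment δ → IsReparametrizationOf δ γ := by
  obtain ⟨z, hz, rfl⟩ := hsurj p
  obtain ⟨x, hx, rfl⟩ := hsurj q
  have hline : ∀ t ∈ Icc (0 : ℝ) 1, AffineMap.lineMap z x t ∈ D := fun t ht =>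
    hD.segment_subset hz hx (segment_eq_image_lineMap ℝ z x ▸ mem_image_of_mem _ ht)
  have hlip : LipschitzOnWith (nndist z x) (fun t : ℝ => f (AffineMap.lineMap z x t))
      (Icc 0 1) := fun s hs t ht => by
    rw [hf _ (hline s hs) _ (hline t ht)]
    exact lipschitzWith_lineMap z x s t
  let γ : Path (f z) (f x) :=
    { toFun := fun t => f (AffineMap.lineMap z x (t : ℝ))
      continuous_toFun := hlip.continuousOn.comp_continuous continuous_subtype_val fun t => t.2
      source' := by simp
      target' := by simp }
  refine ⟨γ, le_antisymm ?_ (edist_le_curveLength γ), fun δ hδ => ?_⟩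
  · have hmono : MonotoneOn (fun t : unitInterval => (t : ℝ)) univ := fun a _ b _ h => h
    have h1 := hlip.comp_eVariationOn_le (s := univ) (g := fun t : unitInterval => (t : ℝ))
      fun t _ => t.2
    have h2 : eVariationOn (fun t : unitInterval => (t : ℝ)) univ ≤ 1 := by
      have h3 := hmono.eVariationOn_eq (mem_univ (0 : unitInterval)) (mem_univ (1 : unitInterval))
      have h4 : (univ : Set unitInterval) ∩ Icc 0 1 = univ := by
        ext t; simpa using unitInterval.le_one' (t := t)
      rw [h4] at h3
      simp [h3]
    calc curveLength γ ≤ (nndist z x : ℝ≥0∞) *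
          eVariationOn (fun t : unitInterval => (t : ℝ)) univ := h1
      _ ≤ (nndist z x : ℝ≥0∞) * 1 := by gcongr
      _ = edist (f z) (f x) := by rw [mul_one, hf z hz x hx, edist_nndist]
  -- Lift `δ` pointwise to `D`. Minimality of its length forces equality in the triangle inequality
  -- through each `d t`.
  choose d hdD hd using fun t => hsurj (δ t)
  have hlen : ∀ {s t}, s ≤ t → dist z (d s) + dist (d s) (d t) + dist (d t) x ≤ dist z x := by
    intro s t hst
    have h1 := edist_add_edist_add_edist_le_curveLength δ hst
    rw [show curveLength δ = _ from hδ, ← hd, ← hd, hf _ hz _ (hdD s), hf _ (hdD s) _ (hdD t),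
      hf _ (hdD t) _ hx, hf _ hz _ hx] at h1
    simp only [edist_dist] at h1
    rwa [← ENNReal.ofReal_add (by positivity) (by positivity),
      ← ENNReal.ofReal_add (by positivity) (by positivity),
      ENNReal.ofReal_le_ofReal_iff (by positivity)] at h1
  have hbtw : ∀ t, dist z (d t) + dist (d t) x = dist z x := fun t =>
    le_antisymm (by simpa using hlen (le_refl t)) (dist_triangle _ _ _)
  have hinj : ∀ {a b}, a ∈ D → b ∈ D → f a = f b → a = b := fun {a b} ha hb hab => by
    rw [← edist_eq_zero, ← hf a ha b hb, hab, edist_self]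
  have hd0 : d 0 = z := hinj (hdD 0) hz (by rw [hd, δ.source])
  have hd1 : d 1 = x := hinj (hdD 1) hx (by rw [hd, δ.target])
  rcases eq_or_ne z x with rfl | hne
  · refine ⟨id, continuous_id, rfl, rfl, monotone_id, Path.ext (funext fun t => ?_)⟩
    have h1 : d t = z := by
      have := hbtw t
      rw [dist_self, dist_comm (d t)] at this
      exact (dist_eq_zero.1 (by linarith)).symm
    rw [← hd, h1]
    change f z = f (AffineMap.lineMap z z (t : ℝ))
    rw [AffineMap.lineMap_same_apply]
  have hpos : 0 < dist z x := dist_pos.2 hne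
  -- The parameter is the fraction of the distance from `z` already covered; equality in the
  -- triangle inequality puts `d t` on the segment at exactly this parameter.
  let φ : unitInterval → unitInterval := fun t => ⟨dist z (d t) / dist z x, by positivity, by
    rw [div_le_one hpos, ← hbtw t]
    exact le_add_of_nonneg_right dist_nonneg⟩
  have hcont : Continuous d := continuous_iff_continuousAt.2 fun t => by
    rw [ContinuousAt, tendsto_iff_edist_tendsto_0]
    have := tendsto_iff_edist_tendsto_0.1 (δ.continuous.tendsto t)
    simpa only [← hd, hf _ (hdD _) _ (hdD t)] using this
  refine ⟨φ, ?_, ?_, ?_, fun s t hst => ?_, Path.ext (funext fun t => ?_)⟩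
  · exact Continuous.subtype_mk ((continuous_const.dist hcont).div_const _) _
  · exact Subtype.ext (by simp [φ, hd0])
  · exact Subtype.ext (by simp [φ, hd1, hpos.ne'])
  · refine Subtype.mk_le_mk.2 (div_le_div_of_nonneg_right ?_ hpos.le)
    linarith [hlen hst, hbtw t, dist_nonneg (x := d s) (y := d t)]
  · obtain ⟨r, hr, hrd⟩ := dist_add_dist_eq_iff.1 (hbtw t)
    have h1 : (φ t : ℝ) = r := by
      change dist z (d t) / dist z x = r
      rw [← hrd, dist_left_lineMap, Real.norm_of_nonneg hr.1, mul_div_cancel_right₀ _ hpos.ne']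
    change δ t = f (AffineMap.lineMap z x (φ t : ℝ))
    rw [h1, hrd, hd]

end Geodesics

/-! ### The chamber as an isometric model of the orbit space. -/

open OrthGroup in
theorem OrthogonalRepresentation.edist_proj_of_mem_chamber {G : Type*} [Group G]
    [TopologicalSpace G] [CompactSpace G] (ρ : OrthogonalRepresentation G V) {x y z : V}
    (h : IsPolarAt ρ.image ⊤ y) (hz : z ∈ ρ.image.chamber ⊤ y) (hx : x ∈ ρ.image.chamber ⊤ y) :
    edist (ρ.proj z) (ρ.proj x) = edist z x := by
  refine le_antisymm (ρ.edist_proj_le z x) ?_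
  rw [ρ.edist_proj]
  refine le_iInf fun g => ?_
  obtain ⟨k, hk, hkg⟩ := ρ.exists_mem_image g
  rw [← hkg, edist_dist, edist_dist]
  exact ENNReal.ofReal_le_ofReal (h.dist_le_dist_apply hz hx hk)

end Polar

theorem proposition3p2
    {E : Type*} [NormedAddCommGroup E] [NormedSpace ℝ E] [FiniteDimensional ℝ E]
    {G : Type*} [TopologicalSpace G] [ChartedSpace E G] [Group G] [LieGroup 𝓘(ℝ, E) ∞ G]
    [CompactSpace G] [ConnectedSpace G]
    {V : Type*} [NormedAddCommGroup V] [InnerProductSpace ℝ V] [FiniteDimensional ℝ V]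
    (ρ : OrthogonalRepresentation G V) (hρ : ρ.IsPolar) (p q : ρ.OrbitSpace) :
    ∃ γ : Path p q, IsMinimalGeodesicSegment γ ∧
      ∀ δ : Path p q, IsMinimalGeodesicSegment δ → IsReparametrizationOf δ γ := by
  have : CompleteSpace V := FiniteDimensional.complete ℝ V
  obtain ⟨y, hy⟩ := ρ.exists_isPolarAt_image hρ
  refine exists_unique_minimalGeodesicSegment (f := ρ.proj) (OrthGroup.convex_chamber (y := y))
    (fun a ha b hb => ρ.edist_proj_of_mem_chamber hy ha hb) (fun m => ?_) p q
  obtain ⟨v, rfl⟩ := ρ.proj_surjective m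
  obtain ⟨k, hk, hkD, -⟩ :=
    OrthGroup.exists_apply_mem_chamber hy.apply_mem (Submodule.mem_top : v ∈ ⊤) y
  obtain ⟨g, hg⟩ := ρ.exists_apply_of_mem_image hk
  exact ⟨k v, hkD, (ρ.proj_eq_iff.2 ⟨g, (hg v).symm⟩).symm⟩
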